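/- **Setting.** Let $G$ be a group and let $n,r$ be integers with $1\le r\le n-2$. Let $F_n(G)=\bigcup_{i=1}^n Gx_i$ be the free left $G$-act on $x_1,\dots,x_n$, and let $\operatorname{End}F_n(G)$ be its endomorphism monoid, with maps written on the right and composed from left to right. The rank of $\alpha\in\operatorname{End}F_n(G)$ is the number of $G$-orbits in $\operatorname{im}\alpha$. Write $x_k\alpha=w_k^\alpha x_{k\overline\alpha}$ with $w_k^\alpha\in G$ and $\overline\alpha:[1,n]\to[1,n]$. Let $I$ be the set of kernels of endomorphisms of rank $r$, and let $\Lambda$ be the set of tuples $\lambda=(u_1,\dots,u_r)$ with $1\le u_1<\dots<u_r\le n$. For $(i,\lambda)\in I\times\Lambda$ let $H_{i\lambda}$ be the set of endomorphisms with kernel $i$ and image $Gx_{u_1}\cup\dots\cup Gx_{u_r}$. Let $K$ be the set of pairs $(i,\lambda)$ for which $H_{i\lambda}$ is a group $\mathcal H$-class (equivalently, contains an idempotent), and for $(i,\lambda)\in K$ let $\varepsilon_{i\lambda}$ be the idempotent in $H_{i\lambda}$. A symbol $\begin{pmatrix}x_1&\cdots&x_r\\ y_1&\cdots&y_r\end{pmatrix}$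 with $y_j\in F_n(G)$ denotes the endomorphism with $x_j\mapsto y_j$ for $j\le r$ and $x_j\mapsto y_1$ for $j>r$. For $\alpha$ of rank $r$, the district of $\alpha$ is the increasing sequence $(l_1^\alpha,\dots,l_r^\alpha)$ of the minimal elements of the $r$ classes of $\ker\overline\alpha$. For $i\in I$ let $\mathbf r_i$ be the unique endomorphism of rank $r$ with kernel $i$ such that $x_{l_j}\mathbf r_i=x_j$ for all $j\in[1,r]$, where $(l_1,\dots,l_r)$ is the district of $\mathbf r_i$. For $\lambda=(u_1,\dots,u_r)\in\Lambda$ put $\mathbf q_\lambda=\begin{pmatrix}x_1&\cdots&x_r\\ x_{u_1}&\cdots&x_{u_r}\end{pmatrix}$. The sandwich matrix $P=(\mathbf p_{\lambda i})$ has $\mathbf p_{\lambda i}=\mathbf q_\lambda\mathbf r_i$ if this product has rank $r$, and $\mathbf p_{\lambda i}=0$ otherwise; $\mathbf p_{\lambda i}\ne 0$ implies $(i,\lambda)\in K$. Write $\alpha\in P$ if $\alpha$ is a nonzero entry of $P$. Let $E$ be the set of idempotents of $\operatorname{End}F_n(G)$ and $E^*$ the free monoid on $E$. Define words $\mathbf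 h_\lambda\in E^*$, $\lambda\in\Lambda$, recursively: $\mathbf h_{(1,\dots,r)}$ is the empty word; for $\lambda=(u_1,\dots,u_r)\neq(1,\dots,r)$ let $i$ be largest with $u_i-u_{i-1}>1$ (where $u_0=0$), and put $\mathbf h_\lambda=\mathbf h_{(u_1,\dots,u_{i-1},u_i-1,u_{i+1},\dots,u_r)}\,\alpha_\lambda$, where $\alpha_\lambda\in E$ maps $x_k$ to $x_{u_j}$ if $u_{j-1}<k\le u_j$, and to $x_{u_r}$ if $k>u_r$. Let $\overline H$ be the group presented by generators $f_{i,\lambda}$, $(i,\lambda)\in K$, and the relations * (R1) $f_{i,\lambda}=f_{i,\mu}$ whenever $(i,\lambda),(i,\mu)\in K$ and $\mathbf h_\lambda\varepsilon_{i\mu}=\mathbf h_\mu$ in $E^*$; * (R2) $f_{i,\omega(i)}=1$ for $i\in I$, where $\omega(i)\in\Lambda$ is the district of $\mathbf r_i$; * (R3) $f_{i,\lambda}^{-1}f_{i,\mu}=f_{k,\lambda}^{-1}f_{k,\mu}$ whenever $(i,\lambda),(i,\mu),(k,\lambda),(k,\mu)\in K$ and $\begin{bmatrix}\varepsilon_{i\lambda}&\varepsilon_{i\mu}\\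 \varepsilon_{k\lambda}&\varepsilon_{k\mu}\end{bmatrix}$ is a singular square. Here a square $\begin{bmatrix}e&f\\ h&g\end{bmatrix}$ of idempotents with $e\,\mathcal R\,f\,\mathcal L\,g\,\mathcal R\,h\,\mathcal L\,e$ is singular if there is $k\in E$ such that either $ek=e,\ fk=f,\ ke=h,\ kf=g$, or $ke=e,\ kh=h,\ ek=f,\ hk=g$. An element has simple form if, for some $k\ge1$, $m\ge0$ with $k+m\le r$ and some $a\in G$, it equals $$\begin{pmatrix}x_1&\cdots&x_{k-1}&x_k&\cdots&x_{k+m-1}&x_{k+m}&x_{k+m+1}&\cdots&x_r\\ x_1&\cdots&x_{k-1}&x_{k+1}&\cdots&x_{k+m}&ax_k&x_{k+m+1}&\cdots&x_r\end{pmatrix}.$$ **Proposition.** (1) Every $\alpha\in P$ is consistent: for all $i,j\in I$ and $\lambda,\mu\in\Lambda$, if $\mathbf p_{\lambda i}=\mathbf p_{\mu j}=\alpha$, then $f_{i,\lambda}=f_{j,\mu}$ in $\overline H$. (2) If $\alpha\in P$ and $\alpha=\mathbf p_{\lambda j}$, then $f_{j,\lambda}$ is equal in $\overline H$ to a product $f_{i_1,\lambda_1}\cdots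 f_{i_k,\lambda_k}$ with $k\ge1$, where $\mathbf p_{\lambda_t i_t}$ has simple form for every $t\in[1,k]$. -/

import Mathlib

namespace FreeActIG

/-! Throughout, the generators `x_1, …, x_n` are indexed by `Fin n`, so that they are counted from
`0`: the generator `x_k` of the mathematical text is `x G (k - 1)` here. -/

/-- The free left `G`-act on `n` generators: the formal symbols `g x_i`. -/
@[ext]
structure FreeAct (G : Type*) (n : ℕ) where
  coeff : G
  idx : Fin n

/-- The action `g (h x_i) = (g h) x_i`. -/
instance {G : Type*} [Group G] {n : ℕ} : MulAction G (FreeAct G n) where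
  smul g y := ⟨g * y.coeff, y.idx⟩
  one_smul y := FreeAct.ext (one_mul y.coeff) rfl
  mul_smul g h y := FreeAct.ext (mul_assoc g h y.coeff) rfl

/-- The free generator `x_i = 1 x_i`. -/
def x (G : Type*) [Group G] {n : ℕ} (i : Fin n) : FreeAct G n := ⟨1, i⟩

/-- The endomorphisms of the free `G`-act. -/
def EndF (G : Type*) [Group G] (n : ℕ) := FreeAct G n →[G] FreeAct G n

instance {G : Type*} [Group G] {n : ℕ} : FunLike (EndF G n) (FreeAct G n) (FreeAct G n) :=
  inferInstanceAs (FunLike (FreeAct G n →[G] FreeAct G n) (FreeAct G n) (FreeAct G n))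

/-- The endomorphism monoid; endomorphisms are composed from left to right. -/
instance {G : Type*} [Group G] {n : ℕ} : Monoid (EndF G n) where
  mul α β := MulActionHom.comp β α
  one := MulActionHom.id G
  mul_assoc _ _ _ := rfl
  one_mul _ := rfl
  mul_one _ := rfl

section basics
variable {G : Type*} [Group G] {n : ℕ}

theorem EndF.mul_apply (α β : EndF G n) (y : FreeAct G n) : (α * β) y = β (α y) := rfl

theorem EndF.map_smul (α : EndF G n) (g : G) (y : FreeAct G n) : α (g • y) = g • α y :=
  MulActionHom.map_smul (M' := G) α g y

theorem smul_x (y : FreeAct G n) : y.coeff • x G y.idx = y :=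
  FreeAct.ext (mul_one y.coeff) rfl

theorem EndF.apply_eq (α : EndF G n) (y : FreeAct G n) : α y = y.coeff • α (x G y.idx) := by
  rw [← EndF.map_smul, smul_x]

theorem EndF.ext {α β : EndF G n} (h : ∀ k, α (x G k) = β (x G k)) : α = β :=
  DFunLike.ext _ _ fun y => by rw [α.apply_eq, β.apply_eq, h]

end basics

/-- The endomorphism with prescribed values on the free generators. -/
def endOf {G : Type*} [Group G] {n : ℕ} (φ : Fin n → FreeAct G n) : EndF G n :=
  ({ toFun := fun y => y.coeff • φ y.idx
     map_smul' := fun g y => mul_smul g y.coeff (φ y.idx) } : FreeAct G n →[G] FreeAct G n)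

theorem endOf_x {G : Type*} [Group G] {n : ℕ} (φ : Fin n → FreeAct G n) (k : Fin n) :
    endOf φ (x G k) = φ k := one_smul G (φ k)

/-- The rank of `α`: the rank of the free subact `im α`, i.e. its number of `G`-orbits. -/
noncomputable def rank {G : Type*} [Group G] {n : ℕ} (α : EndF G n) : ℕ :=
  ((fun y => MulAction.orbit G y) '' Set.range α).ncard

/-- The kernel of `α`, an equivalence relation (indeed a congruence) on the free act. -/
def ker {G : Type*} [Group G] {n : ℕ} (α : EndF G n) : Setoid (FreeAct G n) :=
  Setoid.ker α

/-- The set `I` of kernels of endomorphisms of rank `r`; it labels the `ℛ`-classes of rank `r`. -/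
def KerIdx (G : Type*) [Group G] (n r : ℕ) := {i : Setoid (FreeAct G n) // ∃ α : EndF G n, rank α = r ∧ ker α = i}

/-- The set `Λ` of strictly increasing `r`-tuples `(u_1 < … < u_r)`; it labels the `ℒ`-classes
of rank `r`. -/
abbrev ImIdx (n r : ℕ) := Fin r ↪o Fin n

/-- The subact `G x_{u_1} ∪ … ∪ G x_{u_r}`. -/
def imSet (G : Type*) [Group G] {n r : ℕ} (u : ImIdx n r) : Set (FreeAct G n) :=
  ⋃ j, MulAction.orbit G (x G (u j))

/-- The `ℋ`-class `H_{iu}` of the endomorphisms with kernel `i` and image `im u`. -/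
def HClass {G : Type*} [Group G] {n r : ℕ} (i : KerIdx G n r) (u : ImIdx n r) : Set (EndF G n) :=
  {α | ker α = i.1 ∧ Set.range α = imSet G u}

/-- The set `K` of the pairs `(i, u)` such that `H_{iu}` is a group, i.e. contains an
idempotent. -/
def GroupIdx (G : Type*) [Group G] (n r : ℕ) : Set (KerIdx G n r × ImIdx n r) :=
  {κ | ∃ e ∈ HClass κ.1 κ.2, IsIdempotentElem e}

/-- The set `E` of idempotents. -/
abbrev Idem (G : Type*) [Group G] (n : ℕ) := {e : EndF G n // IsIdempotentElem e}

/-- An `ℋ`-class contains at most one idempotent. -/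
theorem idempotent_unique {G : Type*} [Group G] {n r : ℕ} {i : KerIdx G n r} {u : ImIdx n r}
    {e f : EndF G n} (he : e ∈ HClass i u) (hf : f ∈ HClass i u) (he2 : IsIdempotentElem e)
    (hf2 : IsIdempotentElem f) : e = f := by
  refine DFunLike.ext _ _ fun y => ?_
  have h1 : f (f y) = f y := DFunLike.congr_fun hf2 y
  have h2 : e (f y) = e y := by
    have : ker f (f y) y := h1
    rw [hf.1, ← he.1] at this
    exact this
  have h3 : f y ∈ Set.range e := by rw [he.2, ← hf.2]; exact ⟨y, rfl⟩
  obtain ⟨z, hz⟩ := h3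
  have h4 : e (e z) = e z := DFunLike.congr_fun he2 z
  rw [← h2, ← hz, h4]

/-- The idempotent `ε_{iu}` of a group `ℋ`-class `H_{iu}`. -/
noncomputable def idem {G : Type*} [Group G] {n r : ℕ} (κ : GroupIdx G n r) : Idem G n :=
  ⟨κ.2.choose, κ.2.choose_spec.2⟩

/-- The set of the minimal elements of the blocks of the kernel of `ᾱ : [1,n] → [1,n]`, where
`x_k α = w_k x_{k ᾱ}`. -/
def blockMins {G : Type*} [Group G] {n : ℕ} (α : EndF G n) : Finset (Fin n) :=
  Finset.univ.filter fun k => ∀ k', (α (x G k')).idx = (α (x G k)).idx → k ≤ k'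

section mins
variable {G : Type*} [Group G] {n : ℕ}

theorem exists_blockMin (α : EndF G n) (k : Fin n) :
    ∃ l ∈ blockMins α, (α (x G l)).idx = (α (x G k)).idx := by
  have hne : (Finset.univ.filter fun k' => (α (x G k')).idx = (α (x G k)).idx).Nonempty :=
    ⟨k, by simp⟩
  have hm := Finset.min'_mem _ hne
  rw [Finset.mem_filter] at hm
  refine ⟨_, ?_, hm.2⟩
  simp only [blockMins, Finset.mem_filter, Finset.mem_univ, true_and]
  intro k' hk'
  exact Finset.min'_le _ _ (by simp only [Finset.mem_filter, Finset.mem_univ, true_and]; rw [hk', hm.2])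

theorem blockMins_inj (α : EndF G n) {k l : Fin n} (hk : k ∈ blockMins α) (hl : l ∈ blockMins α)
    (h : (α (x G k)).idx = (α (x G l)).idx) : k = l := by
  simp only [blockMins, Finset.mem_filter, Finset.mem_univ, true_and] at hk hl
  exact le_antisymm (hk l h.symm) (hl k h)

theorem mem_orbit_iff (y z : FreeAct G n) : z ∈ MulAction.orbit G y ↔ z.idx = y.idx := by
  constructor
  · rintro ⟨g, rfl⟩; rfl
  · intro h
    refine ⟨z.coeff * y.coeff⁻¹, FreeAct.ext ?_ h.symm⟩
    exact inv_mul_cancel_right z.coeff y.coeff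

theorem idx_apply (α : EndF G n) (y : FreeAct G n) : (α y).idx = (α (x G y.idx)).idx := by
  rw [α.apply_eq]; rfl

theorem rank_eq_card_image (α : EndF G n) :
    rank α = (Finset.univ.image fun k => (α (x G k)).idx).card := by
  have h : (fun y => MulAction.orbit G y) '' Set.range α =
      (fun k : Fin n => {z : FreeAct G n | z.idx = k}) ''
        (Finset.univ.image fun k => (α (x G k)).idx : Finset (Fin n)) := by
    have hy : ∀ y : FreeAct G n, MulAction.orbit G y = {z : FreeAct G n | z.idx = y.idx} :=
      fun y => Set.ext fun z => mem_orbit_iff y z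
    ext s
    constructor
    · rintro ⟨_, ⟨y, rfl⟩, rfl⟩
      exact ⟨(α y).idx, by simp [idx_apply α y], (hy _).symm⟩
    · rintro ⟨k, hk, rfl⟩
      simp only [Finset.coe_image, Finset.coe_univ, Set.image_univ, Set.mem_range] at hk
      obtain ⟨l, rfl⟩ := hk
      exact ⟨α (x G l), ⟨_, rfl⟩, hy _⟩
  rw [rank, h, Set.ncard_image_of_injective, Set.ncard_coe_finset]
  intro k l hkl
  have : x G k ∈ {z : FreeAct G n | z.idx = l} := by
    rw [← show {z : FreeAct G n | z.idx = k} = {z : FreeAct G n | z.idx = l} from hkl]; rfl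
  exact this

theorem card_blockMins (α : EndF G n) : (blockMins α).card = rank α := by
  rw [rank_eq_card_image]
  have : (Finset.univ.image fun k => (α (x G k)).idx) =
      (blockMins α).image fun k => (α (x G k)).idx := by
    ext j
    simp only [Finset.mem_image, Finset.mem_univ, true_and]
    constructor
    · rintro ⟨k, rfl⟩; exact exists_blockMin α k
    · rintro ⟨k, -, h⟩; exact ⟨k, h⟩
  rw [this, Finset.card_image_of_injOn]
  intro k hk l hl h
  exact blockMins_inj α hk hl h

theorem ker_idx {α β : EndF G n} (h : ker α = ker β) (k l : Fin n) :
    (α (x G k)).idx = (α (x G l)).idx ↔ (β (x G k)).idx = (β (x G l)).idx := by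
  have key : ∀ α β : EndF G n, ker α = ker β →
      (α (x G k)).idx = (α (x G l)).idx → (β (x G k)).idx = (β (x G l)).idx := by
    intro α β h hkl
    have : α (x G l) ∈ MulAction.orbit G (α (x G k)) := (mem_orbit_iff _ _).2 hkl.symm
    obtain ⟨g, hg⟩ := this
    have h1 : ker α (g • x G k) (x G l) := by
      change α _ = α _
      rw [α.map_smul]; exact hg
    rw [h] at h1
    have h2 : β (g • x G k) = β (x G l) := h1
    rw [← h2, β.map_smul]; rfl
  exact ⟨key α β h, key β α h.symm⟩

theorem blockMins_congr {α β : EndF G n} (h : ker α = ker β) : blockMins α = blockMins β := by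
  ext k
  simp only [blockMins, Finset.mem_filter, Finset.mem_univ, true_and]
  exact forall_congr' fun k' => by rw [ker_idx h k' k]

end mins

/-- The district `(l_1 < … < l_r)` of an endomorphism `α` of rank `r`: the increasing sequence of
the minimal elements of the blocks of `ker ᾱ`. -/
def district {G : Type*} [Group G] {n r : ℕ} (α : EndF G n) (h : rank α = r) : ImIdx n r :=
  (blockMins α).orderEmbOfFin ((card_blockMins α).trans h)

/-- The transversal `Θ`: the endomorphisms `α` of rank `r` with `x_{l_j} α = x_j` for all `j`, where
`(l_1, …, l_r)` is the district of `α`. -/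
def Theta (G : Type*) [Group G] {n r : ℕ} (hrn : r ≤ n) : Set (EndF G n) :=
  {α | ∃ h : rank α = r, ∀ j : Fin r, α (x G (district α h j)) = x G (Fin.castLE hrn j)}

theorem existsUnique_theta {G : Type*} [Group G] {n r : ℕ} (hrn : r ≤ n) (i : KerIdx G n r) :
    ∃! α : EndF G n, α ∈ Theta G hrn ∧ ker α = i.1 := by
  obtain ⟨i, β, hβ, rfl⟩ := i
  -- each `k` lies in the block of exactly one member of the district of `β`
  have hmin : ∀ k, ∃ j : Fin r, (β (x G (district β hβ j))).idx = (β (x G k)).idx := by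
    intro k
    obtain ⟨l, hl, hlk⟩ := exists_blockMin β k
    have : l ∈ Set.range (district β hβ) := by
      rw [district, Finset.range_orderEmbOfFin]; exact hl
    obtain ⟨j, rfl⟩ := this
    exact ⟨j, hlk⟩
  have hmem : ∀ j, district β hβ j ∈ blockMins β := fun j => Finset.orderEmbOfFin_mem _ _ j
  have hinj : ∀ j j', (β (x G (district β hβ j))).idx = (β (x G (district β hβ j'))).idx →
      j = j' := fun j j' h => (district β hβ).injective (blockMins_inj β (hmem j) (hmem j') h)
  choose J hJ using hmin
  have hJd : ∀ j, J (district β hβ j) = j := fun j => hinj _ _ (hJ _)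
  let α : EndF G n := endOf fun k =>
    ⟨(β (x G k)).coeff * (β (x G (district β hβ (J k)))).coeff⁻¹, Fin.castLE hrn (J k)⟩
  have hαx : ∀ k, α (x G k) =
      ⟨(β (x G k)).coeff * (β (x G (district β hβ (J k)))).coeff⁻¹, Fin.castLE hrn (J k)⟩ :=
    fun k => endOf_x _ k
  have hJiff : ∀ k l, J k = J l ↔ (β (x G k)).idx = (β (x G l)).idx := by
    intro k l
    constructor
    · intro h; rw [← hJ k, ← hJ l, h]
    · intro h; exact hinj _ _ (by rw [hJ, hJ, h])
  have hcast : ∀ a b : Fin r, Fin.castLE hrn a = Fin.castLE hrn b ↔ a = b :=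
    fun a b => (Fin.castLE_injective hrn).eq_iff
  have hker : ker α = ker β := by
    ext y z
    change α y = α z ↔ β y = β z
    have e : ∀ (γ : EndF G n) (y : FreeAct G n),
        γ y = ⟨y.coeff * (γ (x G y.idx)).coeff, (γ (x G y.idx)).idx⟩ := fun γ y => γ.apply_eq y
    rw [e α, e α z, e β, e β z, FreeAct.mk.injEq, FreeAct.mk.injEq, hαx, hαx]
    simp only
    rw [hcast, hJiff]
    constructor
    · rintro ⟨h1, h2⟩
      rw [(hJiff _ _).2 h2, ← mul_assoc, ← mul_assoc] at h1
      exact ⟨mul_right_cancel h1, h2⟩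
    · rintro ⟨h1, h2⟩
      refine ⟨?_, h2⟩
      rw [(hJiff _ _).2 h2, ← mul_assoc, ← mul_assoc, h1]
  have hbm : blockMins α = blockMins β := blockMins_congr hker
  have hrk : rank α = r := by rw [← card_blockMins, hbm, card_blockMins, hβ]
  have hdis : ∀ γ : EndF G n, ker γ = ker β → ∀ h : rank γ = r, district γ h = district β hβ := by
    intro γ hγ h
    simp only [district, blockMins_congr hγ]
  refine ⟨α, ⟨⟨hrk, fun j => ?_⟩, hker⟩, ?_⟩
  · rw [hdis α hker, hαx, hJd]
    exact FreeAct.ext (mul_inv_cancel _) rfl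
  · rintro γ ⟨⟨hγr, hγ⟩, hγk⟩
    have hγk : ker γ = ker β := hγk
    rw [hdis γ hγk] at hγ
    refine EndF.ext fun k => ?_
    have hαd : ∀ j, α (x G (district β hβ j)) = x G (Fin.castLE hrn j) := by
      intro j
      rw [hαx, hJd]
      exact FreeAct.ext (mul_inv_cancel _) rfl
    have h1 : γ (x G k) ∈ MulAction.orbit G (γ (x G (district β hβ (J k)))) := by
      rw [mem_orbit_iff, ker_idx hγk]
      exact (hJ k).symm
    obtain ⟨g, hg⟩ := h1
    have h2 : ker γ (g • x G (district β hβ (J k))) (x G k) := by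
      change γ _ = γ _
      rw [γ.map_smul]; exact hg
    rw [hγk, ← hker] at h2
    have h3 : α (g • x G (district β hβ (J k))) = α (x G k) := h2
    rw [← h3, α.map_smul, hαd, ← hγ]
    exact hg.symm

/-- The element `𝐫_i`: the unique element of `Θ` with kernel `i`. -/
noncomputable def rElt {G : Type*} [Group G] {n r : ℕ} (hrn : r ≤ n) (i : KerIdx G n r) :
    EndF G n :=
  (existsUnique_theta hrn i).choose

theorem rElt_spec {G : Type*} [Group G] {n r : ℕ} (hrn : r ≤ n) (i : KerIdx G n r) :
    rElt hrn i ∈ Theta G hrn ∧ ker (rElt hrn i) = i.1 :=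
  (existsUnique_theta hrn i).choose_spec.1

theorem rank_rElt {G : Type*} [Group G] {n r : ℕ} (hrn : r ≤ n) (i : KerIdx G n r) :
    rank (rElt hrn i) = r :=
  (rElt_spec hrn i).1.choose

/-- The endomorphism which the abbreviated two-row symbol with columns `x_j ↦ φ_j`, `1 ≤ j ≤ r`,
stands for: the remaining generators `x_{r+1}, …, x_n` are mapped to `φ_1`. -/
def twoRow {G : Type*} [Group G] {n r : ℕ} (hr : 1 ≤ r) (φ : Fin r → FreeAct G n) : EndF G n :=
  endOf fun k => if h : (k : ℕ) < r then φ ⟨k, h⟩ else φ ⟨0, hr⟩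

/-- The element `𝐪_u`, given by `x_j ↦ x_{u_j}`. -/
def qElt (G : Type*) [Group G] {n r : ℕ} (hr : 1 ≤ r) (u : ImIdx n r) : EndF G n :=
  twoRow hr fun j => x G (u j)

/-- The sandwich matrix `P = (𝐩_{ui})`, with `𝐩_{ui} = 𝐪_u 𝐫_i` if this product has rank `r`, and
`𝐩_{ui} = 0` otherwise. -/
noncomputable def sandwich {G : Type*} [Group G] {n r : ℕ} (hr : 1 ≤ r) (hrn : r ≤ n)
    (u : ImIdx n r) (i : KerIdx G n r) : WithZero (EndF G n) :=
  if rank (qElt G hr u * rElt hrn i) = r then ((qElt G hr u * rElt hrn i : EndF G n) : WithZero _)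
  else 0

/-- A pair that yields a nonzero entry of the sandwich matrix lies in `K`. -/
theorem mem_groupIdx {G : Type*} [Group G] {n r : ℕ} {hr : 1 ≤ r} {hrn : r ≤ n} {u : ImIdx n r}
    {i : KerIdx G n r} {α : EndF G n} (h : sandwich hr hrn u i = α) :
    (i, u) ∈ GroupIdx G n r := by
  have hrank : rank (qElt G hr u * rElt hrn i) = r := by
    by_contra hne
    rw [sandwich, if_neg hne] at h
    exact WithZero.zero_ne_coe h
  set ρ := rElt hrn i with hρ
  have hρr : rank ρ = r := rank_rElt hrn i
  rw [rank_eq_card_image] at hρr hrank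
  -- the indices hit by `𝐪_u 𝐫_i` are those hit by `𝐫_i` on `u_1, …, u_r`
  have hq : (Finset.univ.image fun k => ((qElt G hr u * ρ) (x G k)).idx) =
      Finset.univ.image fun j : Fin r => (ρ (x G (u j))).idx := by
    ext a
    simp only [Finset.mem_image, Finset.mem_univ, true_and, EndF.mul_apply, qElt, twoRow, endOf_x]
    constructor
    · rintro ⟨k, rfl⟩
      split_ifs with hk
      · exact ⟨_, rfl⟩
      · exact ⟨_, rfl⟩
    · rintro ⟨j, rfl⟩
      refine ⟨Fin.castLE hrn j, ?_⟩
      rw [dif_pos (show ((Fin.castLE hrn j : Fin n) : ℕ) < r from j.2)]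
      rfl
  rw [hq] at hrank
  have hinj : Function.Injective fun j : Fin r => (ρ (x G (u j))).idx := by
    rw [← Set.injOn_univ, ← Finset.coe_univ]
    apply Finset.card_image_iff.1
    rw [hrank, Finset.card_univ, Fintype.card_fin]
  have himg : (Finset.univ.image fun j : Fin r => (ρ (x G (u j))).idx) =
      Finset.univ.image fun k => (ρ (x G k)).idx := by
    apply Finset.eq_of_subset_of_card_le
    · intro a ha
      simp only [Finset.mem_image, Finset.mem_univ, true_and] at ha ⊢
      obtain ⟨j, rfl⟩ := ha
      exact ⟨_, rfl⟩
    · rw [hrank, hρr]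
  have hex : ∀ k, ∃ y ∈ imSet G u, ρ y = ρ (x G k) := by
    intro k
    have : (ρ (x G k)).idx ∈ Finset.univ.image fun j : Fin r => (ρ (x G (u j))).idx := by
      rw [himg]; simp
    simp only [Finset.mem_image, Finset.mem_univ, true_and] at this
    obtain ⟨j, hj⟩ := this
    obtain ⟨g, hg⟩ := (mem_orbit_iff (ρ (x G (u j))) (ρ (x G k))).2 hj.symm
    refine ⟨g • x G (u j), Set.mem_iUnion.2 ⟨j, g, rfl⟩, ?_⟩
    rw [ρ.map_smul]; exact hg
  have hinjOn : ∀ y ∈ imSet G u, ∀ z ∈ imSet G u, ρ y = ρ z → y = z := by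
    intro y hy z hz hyz
    obtain ⟨j, hj⟩ := Set.mem_iUnion.1 hy
    obtain ⟨j', hj'⟩ := Set.mem_iUnion.1 hz
    obtain ⟨g, rfl⟩ := hj
    obtain ⟨g', rfl⟩ := hj'
    simp only [ρ.map_smul] at hyz
    have hyi := congrArg FreeAct.idx hyz
    have hjj : j = j' := hinj hyi
    subst hjj
    have : g * (ρ (x G (u j))).coeff = g' * (ρ (x G (u j))).coeff := congrArg FreeAct.coeff hyz
    rw [mul_right_cancel this]
  choose Y hY hρY using hex
  let e : EndF G n := endOf Y
  have hsm : ∀ (g : G) (y : FreeAct G n), y ∈ imSet G u → g • y ∈ imSet G u := by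
    intro g y hy
    obtain ⟨j, g', rfl⟩ := Set.mem_iUnion.1 hy
    exact Set.mem_iUnion.2 ⟨j, g * g', mul_smul _ _ _⟩
  have he : ∀ y, e y ∈ imSet G u := fun y => hsm _ _ (hY _)
  have hρe : ∀ y, ρ (e y) = ρ y := by
    intro y
    rw [e.apply_eq, ρ.map_smul, ρ.apply_eq y, ← hρY]
    simp only [e, endOf_x]
  have hee : ∀ y, y ∈ imSet G u → e y = y := fun y hy => hinjOn _ (he y) _ hy (hρe y)
  refine ⟨e, ⟨?_, ?_⟩, DFunLike.ext _ _ fun y => hee _ (he y)⟩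
  · rw [← (rElt_spec hrn i).2]
    ext y z
    change e y = e z ↔ ρ y = ρ z
    constructor
    · intro hyz; rw [← hρe y, hyz, hρe]
    · intro hyz; exact hinjOn _ (he y) _ (he z) (by rw [hρe, hρe, hyz])
  · ext y
    constructor
    · rintro ⟨z, rfl⟩; exact he z
    · intro hy; exact ⟨y, hee y hy⟩

/-- The element `α_u`: it maps `x_k` to `x_{u_j}` if `u_{j-1} < k ≤ u_j` (with `u_0 = 0`), and to
`x_{u_r}` if `k > u_r`. -/
def stepElt (G : Type*) [Group G] {n r : ℕ} (hr : 1 ≤ r) (u : ImIdx n r) : EndF G n :=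
  endOf fun k =>
    if h : (Finset.univ.filter fun j => k ≤ u j).Nonempty then
      x G (u ((Finset.univ.filter fun j => k ≤ u j).min' h))
    else x G (u ⟨r - 1, Nat.sub_lt hr Nat.one_pos⟩)

theorem stepElt_idempotent (G : Type*) [Group G] {n r : ℕ} (hr : 1 ≤ r) (u : ImIdx n r) :
    IsIdempotentElem (stepElt G hr u) := by
  have key : ∀ j, stepElt G hr u (x G (u j)) = x G (u j) := by
    intro j
    have hne : (Finset.univ.filter fun j' => u j ≤ u j').Nonempty := ⟨j, by simp⟩
    rw [stepElt, endOf_x, dif_pos hne]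
    have hm := u.le_iff_le.1 (Finset.mem_filter.1 (Finset.min'_mem _ hne)).2
    have hle := Finset.min'_le (Finset.univ.filter fun j' => u j ≤ u j') j (by simp)
    rw [le_antisymm hle hm]
  refine EndF.ext fun k => ?_
  rw [EndF.mul_apply]
  have : ∃ j, stepElt G hr u (x G k) = x G (u j) := by
    rw [stepElt, endOf_x]
    split_ifs with h
    · exact ⟨_, rfl⟩
    · exact ⟨_, rfl⟩
  obtain ⟨j, hj⟩ := this
  rw [hj, key]

/-- The positions `i` with `u_i - u_{i-1} > 1`, where `u_0 = 0` (all indices and entries counted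
from `1`; counted from `0`, an entry is lowered by one). -/
def gaps {n r : ℕ} (u : ImIdx n r) : Finset (Fin r) :=
  Finset.univ.filter fun i =>
    (if (i : ℕ) = 0 then 0 else (u ⟨i - 1, lt_of_le_of_lt (Nat.sub_le _ _) i.2⟩ : ℕ) + 1) < (u i : ℕ)

/-- The tuple obtained from `u` by replacing `u_i` by `u_i - 1`, where `i` is the largest position
with `u_i - u_{i-1} > 1`. -/
def lower {n r : ℕ} (u : ImIdx n r) (h : (gaps u).Nonempty) : ImIdx n r :=
  OrderEmbedding.ofStrictMono
    (Function.update u ((gaps u).max' h)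
      ⟨(u ((gaps u).max' h) : ℕ) - 1, lt_of_le_of_lt (Nat.sub_le _ _) (u ((gaps u).max' h)).2⟩) (by
    have hm := (gaps u).max'_mem h
    set i := (gaps u).max' h
    simp only [gaps, Finset.mem_filter, Finset.mem_univ, true_and] at hm
    intro a b hab
    have huab : u a < u b := u.strictMono hab
    by_cases hb : b = i
    · have ha : a ≠ i := fun ha => by rw [ha, hb] at hab; exact lt_irrefl _ hab
      rw [hb, Function.update_self, Function.update_of_ne ha]
      rw [hb] at hab
      have hab' : (a : ℕ) < i := hab
      rw [if_neg (by omega)] at hm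
      have h1 : u a ≤ u ⟨i - 1, lt_of_le_of_lt (Nat.sub_le _ _) i.2⟩ := by
        rw [u.le_iff_le, Fin.le_def]
        change (a : ℕ) ≤ i - 1
        omega
      rw [Fin.le_def] at h1
      rw [Fin.lt_def]
      change (u a : ℕ) < (u i : ℕ) - 1
      omega
    · rw [Function.update_of_ne hb]
      by_cases ha : a = i
      · rw [ha, Function.update_self, Fin.lt_def]
        rw [ha, Fin.lt_def] at huab
        change (u i : ℕ) - 1 < u b
        omega
      · rw [Function.update_of_ne ha]; exact huab)

theorem lower_sum_lt {n r : ℕ} (u : ImIdx n r) (h : (gaps u).Nonempty) :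
    ∑ j, (lower u h j : ℕ) < ∑ j, (u j : ℕ) := by
  have hm := (gaps u).max'_mem h
  have hlow : ∀ j, lower u h j = Function.update u ((gaps u).max' h)
      ⟨(u ((gaps u).max' h) : ℕ) - 1, lt_of_le_of_lt (Nat.sub_le _ _) (u ((gaps u).max' h)).2⟩ j :=
    fun j => rfl
  set i := (gaps u).max' h
  simp only [gaps, Finset.mem_filter, Finset.mem_univ, true_and] at hm
  refine Finset.sum_lt_sum (fun j _ => ?_) ⟨i, Finset.mem_univ i, ?_⟩
  · rw [hlow]
    by_cases hj : j = i
    · rw [hj, Function.update_self]; exact Nat.sub_le _ _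
    · rw [Function.update_of_ne hj]
  · rw [hlow, Function.update_self]
    change (u i : ℕ) - 1 < u i
    omega

/-- The Schreier words `𝐡_u` in the free monoid on `E`: the empty word for `u = (1, 2, …, r)`, which
is the only tuple without a position `i` such that `u_i - u_{i-1} > 1`, and otherwise
`𝐡_u = 𝐡_{u'} α_u`, where `u' = lower u`. -/
def schreierWord (G : Type*) [Group G] {n r : ℕ} (hr : 1 ≤ r) (u : ImIdx n r) :
    FreeMonoid (Idem G n) :=
  if h : (gaps u).Nonempty then
    schreierWord G hr (lower u h) * FreeMonoid.of ⟨stepElt G hr u, stepElt_idempotent G hr u⟩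
  else 1
termination_by ∑ j, (u j : ℕ)
decreasing_by exact lower_sum_lt u h

/-- Green's relation `ℛ` on a monoid: `a S = b S`. -/
def GreenR {S : Type*} [Monoid S] (a b : S) : Prop :=
  (Set.range fun s => a * s) = Set.range fun s => b * s

/-- Green's relation `ℒ` on a monoid: `S a = S b`. -/
def GreenL {S : Type*} [Monoid S] (a b : S) : Prop :=
  (Set.range fun s => s * a) = Set.range fun s => s * b

/-- `(e, f; h, g)` (rows `e f` and `h g`) is an `E`-square: `e ℛ f ℒ g ℛ h ℒ e`. -/
def IsESquare {S : Type*} [Monoid S] (e f h g : {a : S // IsIdempotentElem a}) : Prop :=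
  GreenR e.1 f.1 ∧ GreenL f.1 g.1 ∧ GreenR g.1 h.1 ∧ GreenL h.1 e.1

/-- The square with rows `e f` and `h g` is a singular `E`-square. -/
def IsSingularSquare {S : Type*} [Monoid S] (e f h g : {a : S // IsIdempotentElem a}) : Prop :=
  IsESquare e f h g ∧ ∃ k : {a : S // IsIdempotentElem a},
    (e.1 * k.1 = e.1 ∧ f.1 * k.1 = f.1 ∧ k.1 * e.1 = h.1 ∧ k.1 * f.1 = g.1) ∨
    (k.1 * e.1 = e.1 ∧ k.1 * h.1 = h.1 ∧ e.1 * k.1 = f.1 ∧ h.1 * k.1 = g.1)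

/-- The defining relations `Σ` on the generators `f_{i,u}`, `(i,u) ∈ K`. A relation `a = b` is
recorded as the element `a b⁻¹` of the free group. -/
inductive Rels (G : Type*) [Group G] {n r : ℕ} (hr : 1 ≤ r) (hrn : r ≤ n) :
    FreeGroup (GroupIdx G n r) → Prop
  /-- (R1) `f_{i,u} = f_{i,v}` if `𝐡_u ε_{iv} = 𝐡_v` as words. -/
  | schreier (i : KerIdx G n r) (u v : ImIdx n r) (hu : (i, u) ∈ GroupIdx G n r)
      (hv : (i, v) ∈ GroupIdx G n r)
      (h : schreierWord G hr u * FreeMonoid.of (idem ⟨(i, v), hv⟩) = schreierWord G hr v) :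
      Rels G hr hrn (FreeGroup.of ⟨(i, u), hu⟩ * (FreeGroup.of ⟨(i, v), hv⟩)⁻¹)
  /-- (R2) `f_{i,ω(i)} = 1`, where `ω(i)` is the district of `𝐫_i`. -/
  | anchor (i : KerIdx G n r)
      (hi : (i, district (rElt hrn i) (rank_rElt hrn i)) ∈ GroupIdx G n r) :
      Rels G hr hrn (FreeGroup.of ⟨(i, district (rElt hrn i) (rank_rElt hrn i)), hi⟩)
  /-- (R3) `f_{i,u}⁻¹ f_{i,v} = f_{k,u}⁻¹ f_{k,v}` if the square with rows `ε_{iu} ε_{iv}` and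
  `ε_{ku} ε_{kv}` is singular. -/
  | square (i k : KerIdx G n r) (u v : ImIdx n r) (hiu : (i, u) ∈ GroupIdx G n r)
      (hiv : (i, v) ∈ GroupIdx G n r) (hku : (k, u) ∈ GroupIdx G n r)
      (hkv : (k, v) ∈ GroupIdx G n r)
      (h : IsSingularSquare (idem ⟨(i, u), hiu⟩) (idem ⟨(i, v), hiv⟩) (idem ⟨(k, u), hku⟩)
        (idem ⟨(k, v), hkv⟩)) :
      Rels G hr hrn
        (((FreeGroup.of ⟨(i, u), hiu⟩)⁻¹ * FreeGroup.of ⟨(i, v), hiv⟩) *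
          ((FreeGroup.of ⟨(k, u), hku⟩)⁻¹ * FreeGroup.of ⟨(k, v), hkv⟩)⁻¹)

/-- The group `H̄` given by the presentation `⟨F : Σ⟩`. -/
abbrev HBar (G : Type*) [Group G] {n r : ℕ} (hr : 1 ≤ r) (hrn : r ≤ n) :=
  PresentedGroup {w | Rels G hr hrn w}

/-- The generator `f_{i,u}` of `H̄`. -/
def gen {G : Type*} [Group G] {n r : ℕ} (hr : 1 ≤ r) (hrn : r ≤ n) (κ : GroupIdx G n r) :
    HBar G hr hrn :=
  PresentedGroup.of κ

/-- `α` is consistent: `f_{i,u} = f_{j,v}` whenever `𝐩_{ui} = 𝐩_{vj} = α`. -/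
def Consistent {G : Type*} [Group G] {n r : ℕ} (hr : 1 ≤ r) (hrn : r ≤ n) (α : EndF G n) : Prop :=
  ∀ (i j : KerIdx G n r) (u v : ImIdx n r) (hu : sandwich hr hrn u i = α)
    (hv : sandwich hr hrn v j = α),
    gen hr hrn ⟨(i, u), mem_groupIdx hu⟩ = gen hr hrn ⟨(j, v), mem_groupIdx hv⟩

/-- `α` has simple form: for some `k ≥ 1`, `m ≥ 0` with `k + m ≤ r` and some `a ∈ G` it is given by
`x_j ↦ x_{j+1}` for `k ≤ j < k + m`, `x_{k+m} ↦ a x_k`, and `x_j ↦ x_j` for all other `j ≤ r`.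
(Below, `k` and `j` are counted from `0`.) -/
def SimpleForm {G : Type*} [Group G] {n r : ℕ} (hr : 1 ≤ r) (hrn : r ≤ n) (α : EndF G n) : Prop :=
  ∃ (k m : ℕ) (h : k + m < r) (a : G), α = twoRow hr fun j : Fin r =>
    if hj : k ≤ (j : ℕ) ∧ (j : ℕ) < k + m then x G ⟨j + 1, by omega⟩
    else if (j : ℕ) = k + m then a • x G ⟨k, by omega⟩
    else x G (Fin.castLE hrn j)

end FreeActIG

/-! Each kernel `i` is encoded by the word of length `n` that lists the values of `𝐫_i`. The words
that arise are the normal ones (`exists_word_eq`), and `𝐩_{ui}` is the subword at the positions `u`,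
nonzero exactly when it is monomial. By `exists_word_eqOn`, a partial word extends to some `𝐫_k`
once suitable positions carry `x_1, …, x_r` early enough, so kernels can be prescribed on the few
positions that matter.

If two words differ at the positions `u` and `v` only by an invertible change of letters `γ`, the
four idempotents form a singular square, and (R3) links the four generators (`genAt_square`). With
(R1) and (R2) this gives `f_{i,u} = 1` whenever `𝐩_{ui}` is the identity (`genAt_eq_one`). Hence a
square with the identity in one corner becomes a rule: an equality of generators (`genAt_congr_ker`,
`genAt_congr_im`) or a factorization (`genAt_factor`).

An entry of simple form arises from `x_1 ⋯ x_r` with an extra letter `a x_k` inserted after `x_k`: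
deleting `x_k` gives the entry, deleting `a x_k` gives the identity. All occurrences of such an
extended word yield the same generator (`genAt_simpleWord_congr`). For a general entry, let `s` be
the last position whose letter `a x_k` is not `x_s`. The first occurrences of `x_1, …, x_s` followed
by `u_s, …, u_r` carry an extended word. This splits off a simple factor determined by the entry
alone and leaves an entry fixing all letters from `s` on (`exists_factorization`). Induction on `s`
gives both claims together. -/

namespace FreeActIG

/-! ### Kernels as normal words -/

section words
variable {G : Type*} [Group G] {n r : ℕ}

theorem smul_idx (g : G) (y : FreeAct G n) : (g • y).idx = y.idx := rfl

theorem smul_coeff (g : G) (y : FreeAct G n) : (g • y).coeff = g * y.coeff := rfl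

/-- The inclusion of the free act on `r` generators into the one on `n ≥ r` generators. -/
def incl (hrn : r ≤ n) (y : FreeAct G r) : FreeAct G n := ⟨y.coeff, Fin.castLE hrn y.idx⟩

theorem incl_injective {G : Type*} {n r : ℕ} (hrn : r ≤ n) : Function.Injective (incl (G := G) hrn) := by
  intro y z h
  rw [incl, incl, FreeAct.mk.injEq] at h
  exact FreeAct.ext h.1 (Fin.castLE_injective hrn h.2)

theorem exists_district_idx_eq {α : EndF G n} (h : rank α = r) (k : Fin n) :
    ∃ j, (α (x G (district α h j))).idx = (α (x G k)).idx ∧ district α h j ≤ k := by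
  obtain ⟨l, hl, hlk⟩ := exists_blockMin α k
  have hr : l ∈ Set.range (district α h) := by
    rw [district, Finset.range_orderEmbOfFin]; exact hl
  obtain ⟨j, rfl⟩ := hr
  refine ⟨j, hlk, ?_⟩
  simp only [blockMins, Finset.mem_filter, Finset.mem_univ, true_and] at hl
  exact hl k hlk.symm

/-- The district of `𝐫_i`. -/
noncomputable def dist (hrn : r ≤ n) (i : KerIdx G n r) : ImIdx n r :=
  district (rElt hrn i) (rank_rElt hrn i)

theorem rElt_dist (hrn : r ≤ n) (i : KerIdx G n r) (j : Fin r) :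
    rElt hrn i (x G (dist hrn i j)) = x G (Fin.castLE hrn j) :=
  (rElt_spec hrn i).1.choose_spec j

theorem rElt_idx_lt (hrn : r ≤ n) (i : KerIdx G n r) (t : Fin n) :
    ((rElt hrn i (x G t)).idx : ℕ) < r := by
  obtain ⟨j, hj, -⟩ := exists_district_idx_eq (rank_rElt hrn i) t
  rw [← hj]
  change ((rElt hrn i (x G (dist hrn i j))).idx : ℕ) < r
  rw [rElt_dist]
  exact j.2

/-- The word of length `n` over the free act on `r` generators which lists the values of `𝐫_i`. -/
noncomputable def word (hrn : r ≤ n) (i : KerIdx G n r) (t : Fin n) : FreeAct G r :=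
  ⟨(rElt hrn i (x G t)).coeff, ⟨(rElt hrn i (x G t)).idx, rElt_idx_lt hrn i t⟩⟩

theorem incl_word (hrn : r ≤ n) (i : KerIdx G n r) (t : Fin n) :
    incl hrn (word hrn i t) = rElt hrn i (x G t) := rfl

theorem word_dist (hrn : r ≤ n) (i : KerIdx G n r) (j : Fin r) :
    word hrn i (dist hrn i j) = x G j :=
  incl_injective hrn (by rw [incl_word, rElt_dist]; rfl)

theorem dist_le (hrn : r ≤ n) (i : KerIdx G n r) (t : Fin n) :
    dist hrn i (word hrn i t).idx ≤ t := by
  obtain ⟨j, hj, hle⟩ := exists_district_idx_eq (rank_rElt hrn i) t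
  have : (word hrn i t).idx = j := by
    apply Fin.ext
    change ((rElt hrn i (x G t)).idx : ℕ) = j
    rw [← hj]
    change ((rElt hrn i (x G (dist hrn i j))).idx : ℕ) = j
    rw [rElt_dist]
    rfl
  rw [this]
  exact hle

theorem rElt_eq_iff (hrn : r ≤ n) (i : KerIdx G n r) (y z : FreeAct G n) :
    rElt hrn i y = rElt hrn i z ↔
      y.coeff • word hrn i y.idx = z.coeff • word hrn i z.idx := by
  rw [(rElt hrn i).apply_eq y, (rElt hrn i).apply_eq z, ← incl_word, ← incl_word]
  change incl hrn (y.coeff • word hrn i y.idx) = incl hrn (z.coeff • word hrn i z.idx) ↔ _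
  exact (incl_injective hrn).eq_iff

/-- A word in which every letter occurs and is preceded by all smaller letters, the first occurrence
of each letter having trivial coefficient. -/
def Normal (c : Fin n → FreeAct G r) : Prop :=
  (∀ t, ∀ j ≤ (c t).idx, ∃ s ≤ t, c s = x G j) ∧ ∀ j, ∃ t, c t = x G j

/-- Normality makes the first occurrences of the letters appear in the order `x_1, …, x_r`, so the
endomorphism spelled by `c` already lies in the transversal `Θ`. -/
theorem exists_word_eq (hrn : r ≤ n) {c : Fin n → FreeAct G r} (hc : Normal c) :
    ∃ i : KerIdx G n r, word hrn i = c := by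
  let α : EndF G n := endOf fun t => incl hrn (c t)
  have hα : ∀ t, α (x G t) = incl hrn (c t) := fun t => endOf_x _ t
  have hidx : ∀ s t, (α (x G s)).idx = (α (x G t)).idx ↔ (c s).idx = (c t).idx := by
    intro s t
    rw [hα, hα]
    exact (Fin.castLE_injective hrn).eq_iff
  have hrank : rank α = r := by
    rw [rank_eq_card_image]
    have : (Finset.univ.image fun k => (α (x G k)).idx) =
        Finset.univ.image (Fin.castLE hrn) := by
      ext a
      simp only [Finset.mem_image, Finset.mem_univ, true_and, hα]
      constructor
      · rintro ⟨t, rfl⟩; exact ⟨_, rfl⟩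
      · rintro ⟨j, rfl⟩
        obtain ⟨t, ht⟩ := hc.2 j
        exact ⟨t, by rw [ht]; rfl⟩
    rw [this, Finset.card_image_of_injective _ (Fin.castLE_injective hrn), Finset.card_univ,
      Fintype.card_fin]
  have hfirst : ∀ k ∈ blockMins α, ∀ t, (c t).idx = (c k).idx → k ≤ t := by
    intro k hk t ht
    simp only [blockMins, Finset.mem_filter, Finset.mem_univ, true_and] at hk
    exact hk t ((hidx _ _).2 ht)
  have hmem : ∀ j, district α hrank j ∈ blockMins α := fun j => Finset.orderEmbOfFin_mem _ _ j
  have hx : ∀ k ∈ blockMins α, c k = x G (c k).idx := by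
    intro k hk
    obtain ⟨s, hs, hsx⟩ := hc.1 k _ le_rfl
    have := hfirst k hk s (by rw [hsx]; rfl)
    rwa [le_antisymm hs this] at hsx
  -- If the letter at a later district position were not greater, normality would place a copy of it
  -- no later than the earlier district position, against the minimality of the later one.
  have hmono : StrictMono fun j => (c (district α hrank j)).idx := by
    intro a b hab
    by_contra hle
    obtain ⟨s, hs, hsx⟩ := hc.1 _ _ (not_lt.1 hle)
    have := hfirst _ (hmem b) s (by rw [hsx]; rfl)
    exact absurd ((district α hrank).strictMono hab) (not_lt.2 (this.trans hs))
  have hid : ∀ j, (c (district α hrank j)).idx = j := by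
    intro j
    have : (fun j => (c (district α hrank j)).idx) = id :=
      (hmono.range_inj strictMono_id).1 (by
        rw [(Finite.injective_iff_surjective.1 hmono.injective).range_eq, Set.range_id])
    exact congrFun this j
  have hΘ : α ∈ Theta G hrn := by
    refine ⟨hrank, fun j => ?_⟩
    rw [hα, hx _ (hmem j), hid]
    rfl
  let i : KerIdx G n r := ⟨ker α, α, hrank, rfl⟩
  have hi : rElt hrn i = α := (existsUnique_theta hrn i).unique (rElt_spec hrn i) ⟨hΘ, rfl⟩
  refine ⟨i, funext fun t => incl_injective hrn ?_⟩
  rw [incl_word, hi, hα]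

open Classical in
/-- A partial word in which the letters `x_j` at the positions `v_j` are first occurrences can be
completed to the word of some `𝐫_i`. -/
theorem exists_word_eqOn (hr : 1 ≤ r) (hrn : r ≤ n) (A : Set (Fin n)) (e : Fin n → FreeAct G r)
    (v : ImIdx n r) (hvA : ∀ j, v j ∈ A) (hv : ∀ j, e (v j) = x G j)
    (hle : ∀ t ∈ A, v (e t).idx ≤ t) : ∃ i : KerIdx G n r, ∀ t ∈ A, word hrn i t = e t := by
  -- Unused positions are filled with the smallest letter, which needs no letter before it.
  have hc : Normal fun t => if t ∈ A then e t else x G (⟨0, hr⟩ : Fin r) := by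
    refine ⟨fun t j hj => ?_, fun j => ⟨v j, by simp only [if_pos (hvA j), hv]⟩⟩
    by_cases ht : t ∈ A
    · simp only [if_pos ht] at hj
      exact ⟨v j, (v.monotone hj).trans (hle t ht), by simp only [if_pos (hvA j), hv]⟩
    · simp only [if_neg ht] at hj ⊢
      refine ⟨t, le_rfl, ?_⟩
      rw [if_neg ht]
      congr 1
      exact le_antisymm (Fin.mk_le_of_le_val (Nat.zero_le _)) hj
  obtain ⟨i, hi⟩ := exists_word_eq hrn hc
  exact ⟨i, fun t ht => by rw [hi]; exact if_pos ht⟩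

/-! ### Entries of the sandwich matrix as monomial subwords -/

/-- The monomial words: their letters carry pairwise distinct generators. -/
def Monomial (w : Fin r → FreeAct G r) : Prop := Function.Injective fun j => (w j).idx

theorem monomial_x : Monomial (fun j : Fin r => x G j) := fun _ _ h => h

theorem Monomial.exists_inverse {w : Fin r → FreeAct G r} (hw : Monomial w) :
    ∃ δ : EndF G r, (∀ y, δ (endOf w y) = y) ∧ ∀ y, endOf w (δ y) = y := by
  let σ := Equiv.ofBijective _ (Finite.injective_iff_bijective.1 hw)
  let δ : EndF G r := endOf fun l => (w (σ.symm l)).coeff⁻¹ • x G (σ.symm l)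
  have h1 : ∀ j, δ (w j) = x G j := by
    intro j
    have hj : σ.symm (w j).idx = j := σ.symm_apply_apply j
    rw [δ.apply_eq, endOf_x, hj, smul_smul, mul_inv_cancel, one_smul]
  have h2 : ∀ y, δ (endOf w y) = y := by
    intro y
    rw [(endOf w).apply_eq, δ.map_smul, endOf_x, h1, smul_x]
  refine ⟨δ, h2, fun y => ?_⟩
  have h3 : ∀ l, endOf w (δ (x G l)) = x G l := by
    intro l
    have hl : (w (σ.symm l)).idx = l := σ.apply_symm_apply l
    rw [endOf_x, EndF.map_smul, endOf_x]
    refine FreeAct.ext ?_ hl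
    exact inv_mul_cancel _
  rw [δ.apply_eq, EndF.map_smul, h3, smul_x]

theorem twoRow_castLE (hr : 1 ≤ r) (hrn : r ≤ n) (φ : Fin r → FreeAct G n) (j : Fin r) :
    twoRow hr φ (x G (Fin.castLE hrn j)) = φ j := by
  rw [twoRow, endOf_x, dif_pos (show ((Fin.castLE hrn j : Fin n) : ℕ) < r from j.2)]
  rfl

theorem qElt_mul_rElt (hr : 1 ≤ r) (hrn : r ≤ n) (u : ImIdx n r) (i : KerIdx G n r) :
    qElt G hr u * rElt hrn i = twoRow hr fun j => incl hrn (word hrn i (u j)) := by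
  refine EndF.ext fun k => ?_
  rw [EndF.mul_apply, qElt, twoRow, twoRow, endOf_x, endOf_x]
  split_ifs <;> rfl

theorem rank_twoRow_incl_iff (hr : 1 ≤ r) (hrn : r ≤ n) (w : Fin r → FreeAct G r) :
    rank (twoRow hr fun j => incl hrn (w j)) = r ↔ Monomial w := by
  have him : (Finset.univ.image fun k =>
      ((twoRow hr fun j => incl hrn (w j) : EndF G n) (x G k)).idx) =
      Finset.univ.image fun j : Fin r => Fin.castLE hrn (w j).idx := by
    ext a
    simp only [Finset.mem_image, Finset.mem_univ, true_and]
    constructor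
    · rintro ⟨k, rfl⟩
      rw [twoRow, endOf_x]
      split_ifs with hk
      · exact ⟨_, rfl⟩
      · exact ⟨_, rfl⟩
    · rintro ⟨j, rfl⟩
      exact ⟨Fin.castLE hrn j, by rw [twoRow_castLE]; rfl⟩
  have hcard := Finset.card_image_iff (s := (Finset.univ : Finset (Fin r)))
    (f := fun j => Fin.castLE hrn (w j).idx)
  rw [Finset.card_univ, Fintype.card_fin, Finset.coe_univ, Set.injOn_univ] at hcard
  rw [rank_eq_card_image, him, hcard]
  exact (Fin.castLE_injective hrn).of_comp_iff (fun j => (w j).idx)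

theorem sandwich_eq (hr : 1 ≤ r) (hrn : r ≤ n) {u : ImIdx n r} {i : KerIdx G n r}
    (h : Monomial fun j => word hrn i (u j)) :
    sandwich hr hrn u i = (twoRow hr fun j => incl hrn (word hrn i (u j)) : EndF G n) := by
  rw [sandwich, qElt_mul_rElt, if_pos ((rank_twoRow_incl_iff hr hrn _).2 h)]

theorem eq_of_sandwich_eq (hr : 1 ≤ r) (hrn : r ≤ n) {u : ImIdx n r} {i : KerIdx G n r}
    {α : EndF G n} (h : sandwich hr hrn u i = α) :
    Monomial (fun j => word hrn i (u j)) ∧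
      ∀ j, α (x G (Fin.castLE hrn j)) = incl hrn (word hrn i (u j)) := by
  rw [sandwich, qElt_mul_rElt] at h
  split_ifs at h with hm
  · refine ⟨(rank_twoRow_incl_iff hr hrn _).1 hm, fun j => ?_⟩
    rw [← WithZero.coe_inj.1 h, twoRow_castLE]
  · exact absurd h.symm WithZero.coe_ne_zero

theorem Monomial.mem_groupIdx (hr : 1 ≤ r) {hrn : r ≤ n} {u : ImIdx n r} {i : KerIdx G n r}
    (h : Monomial fun j => word hrn i (u j)) : (i, u) ∈ GroupIdx G n r :=
  FreeActIG.mem_groupIdx (sandwich_eq hr hrn h)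

end words

/-! ### Singular squares and the relations (R3), (R2) -/

section squares
variable {G : Type*} [Group G] {n r : ℕ}

theorem mem_imSet_iff (u : ImIdx n r) (y : FreeAct G n) :
    y ∈ imSet G u ↔ ∃ j, y.idx = u j := by
  simp only [imSet, Set.mem_iUnion, mem_orbit_iff]
  rfl

theorem idem_fixes {u : ImIdx n r} {i : KerIdx G n r} {e : EndF G n} (he : e ∈ HClass i u)
    (he2 : IsIdempotentElem e) {y : FreeAct G n} (hy : y ∈ imSet G u) : e y = y := by
  rw [← he.2] at hy
  obtain ⟨z, rfl⟩ := hy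
  exact DFunLike.congr_fun he2 z

theorem greenR_of_ker {i : KerIdx G n r} {u v : ImIdx n r} {e f : EndF G n}
    (he : e ∈ HClass i u) (hf : f ∈ HClass i v) (he2 : IsIdempotentElem e)
    (hf2 : IsIdempotentElem f) : GreenR e f := by
  have key : ∀ {e f : EndF G n}, ker e = ker f → IsIdempotentElem e → e * f = f := by
    intro e f hk he2
    refine DFunLike.ext _ _ fun y => ?_
    have h : ker e (e y) y := DFunLike.congr_fun he2 y
    rw [hk] at h
    exact h
  have hk : ker e = ker f := he.1.trans hf.1.symm
  ext s
  constructor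
  · rintro ⟨t, rfl⟩
    exact ⟨e * t, by simp only [← mul_assoc, key hk.symm hf2]⟩
  · rintro ⟨t, rfl⟩
    exact ⟨f * t, by simp only [← mul_assoc, key hk he2]⟩

theorem greenL_of_range {i k : KerIdx G n r} {u : ImIdx n r} {e f : EndF G n}
    (he : e ∈ HClass i u) (hf : f ∈ HClass k u) (he2 : IsIdempotentElem e)
    (hf2 : IsIdempotentElem f) : GreenL e f := by
  have h1 : e * f = e := DFunLike.ext _ _ fun y => idem_fixes hf hf2 (he.2 ▸ ⟨y, rfl⟩)
  have h2 : f * e = f := DFunLike.ext _ _ fun y => idem_fixes he he2 (hf.2 ▸ ⟨y, rfl⟩)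
  ext s
  constructor
  · rintro ⟨t, rfl⟩
    exact ⟨t * e, by simp only [mul_assoc, h1]⟩
  · rintro ⟨t, rfl⟩
    exact ⟨t * f, by simp only [mul_assoc, h2]⟩

open Classical in
/-- The idempotents of four group `ℋ`-classes form a singular square as soon as the kernels `i` and
`k` match the points of the two images in the same way. -/
theorem isSingularSquare_of_ker {i k : KerIdx G n r} {u v : ImIdx n r} {e f h g : Idem G n}
    (he : e.1 ∈ HClass i u) (hf : f.1 ∈ HClass i v) (hh : h.1 ∈ HClass k u)
    (hg : g.1 ∈ HClass k v)
    (hik : ∀ y ∈ imSet G u, ∀ z ∈ imSet G v, i.1 y z → k.1 y z) : IsSingularSquare e f h g := by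
  refine ⟨⟨greenR_of_ker he hf e.2 f.2, greenL_of_range hf hg f.2 g.2,
    greenR_of_ker hg hh g.2 h.2, greenL_of_range hh he h.2 e.2⟩, ?_⟩
  have hemem : ∀ y, e.1 y ∈ imSet G u := fun y => he.2 ▸ ⟨y, rfl⟩
  have hfmem : ∀ y, f.1 y ∈ imSet G v := fun y => hf.2 ▸ ⟨y, rfl⟩
  have hhmem : ∀ y, h.1 y ∈ imSet G u := fun y => hh.2 ▸ ⟨y, rfl⟩
  have hif : ∀ y, i.1 y (f.1 y) := by
    intro y
    rw [← hf.1]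
    exact (DFunLike.congr_fun f.2 y).symm
  have hef : ∀ y, e.1 (f.1 y) = e.1 y := by
    intro y
    have := hif y
    rw [← he.1] at this
    exact this.symm
  have hfe : ∀ y, f.1 (e.1 y) = f.1 y := by
    intro y
    have h1 : ker e.1 (e.1 y) y := DFunLike.congr_fun e.2 y
    rw [he.1, ← hf.1] at h1
    exact h1
  have hkf : ∀ y ∈ imSet G u, k.1 y (f.1 y) := fun y hy => hik y hy _ (hfmem y) (hif y)
  have hhf : ∀ y ∈ imSet G u, h.1 (f.1 y) = h.1 y := by
    intro y hy
    have := hkf y hy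
    rw [← hh.1] at this
    exact this.symm
  have hgf : ∀ y ∈ imSet G u, g.1 y = f.1 y := by
    intro y hy
    have := hkf y hy
    rw [← hg.1] at this
    exact (show g.1 y = g.1 (f.1 y) from this).trans (idem_fixes hg g.2 (hfmem y))
  have hgh : ∀ y, g.1 (h.1 y) = g.1 y := by
    intro y
    have h1 : ker h.1 (h.1 y) y := DFunLike.congr_fun h.2 y
    rw [hh.1, ← hg.1] at h1
    exact h1
  -- The singularizing idempotent: it carries `im u` into `im v` along `f` and fixes everything
  -- else. Since `f` fixes `im v`, so does `θ`.
  let θ : EndF G n := endOf fun t => if x G t ∈ imSet G u then f.1 (x G t) else x G t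
  have hsm : ∀ (y : FreeAct G n), x G y.idx ∈ imSet G u ↔ y ∈ imSet G u := fun y => by
    rw [mem_imSet_iff, mem_imSet_iff]; rfl
  have hθ : ∀ y, θ y = if y ∈ imSet G u then f.1 y else y := by
    intro y
    rw [θ.apply_eq, endOf_x]
    by_cases hy : y ∈ imSet G u
    · rw [if_pos hy, if_pos ((hsm y).2 hy), ← EndF.map_smul, smul_x]
    · rw [if_neg hy, if_neg (fun h => hy ((hsm y).1 h)), smul_x]
  have hθu : ∀ y ∈ imSet G u, θ y = f.1 y := fun y hy => by rw [hθ, if_pos hy]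
  have hθv : ∀ y ∈ imSet G v, θ y = y := fun y hy => by
    rw [hθ]
    split_ifs
    · exact idem_fixes hf f.2 hy
    · rfl
  refine ⟨⟨θ, DFunLike.ext _ _ fun y => ?_⟩, Or.inr ⟨?_, ?_, ?_, ?_⟩⟩
  · rw [EndF.mul_apply, hθ y]
    split_ifs with hy
    · exact hθv _ (hfmem y)
    · rw [hθ, if_neg hy]
  · refine DFunLike.ext _ _ fun y => ?_
    rw [EndF.mul_apply, hθ]
    split_ifs
    · exact hef y
    · rfl
  · refine DFunLike.ext _ _ fun y => ?_
    rw [EndF.mul_apply, hθ]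
    split_ifs with hy
    · exact hhf y hy
    · rfl
  · refine DFunLike.ext _ _ fun y => ?_
    rw [EndF.mul_apply, hθu _ (hemem y), hfe]
  · refine DFunLike.ext _ _ fun y => ?_
    rw [EndF.mul_apply, hθu _ (hhmem y), ← hgf _ (hhmem y), hgh]

theorem idem_mem (κ : GroupIdx G n r) : (idem κ).1 ∈ HClass κ.1.1 κ.1.2 := κ.2.choose_spec.1

open Classical in
/-- The generator `f_{i,u}`, extended by `1` to the pairs outside `K`. -/
noncomputable def genAt (hr : 1 ≤ r) (hrn : r ≤ n) (i : KerIdx G n r) (u : ImIdx n r) :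
    HBar G hr hrn :=
  if h : (i, u) ∈ GroupIdx G n r then gen hr hrn ⟨(i, u), h⟩ else 1

theorem genAt_eq (hr : 1 ≤ r) (hrn : r ≤ n) {i : KerIdx G n r} {u : ImIdx n r}
    (h : (i, u) ∈ GroupIdx G n r) : genAt hr hrn i u = gen hr hrn ⟨(i, u), h⟩ := dif_pos h

/-- The change of letters `endOf γ` is injective, so `i` and `k` identify the same points of the two
images. This makes the square singular and (R3) applies. -/
theorem genAt_square (hr : 1 ≤ r) {hrn : r ≤ n} {i k : KerIdx G n r} {u v : ImIdx n r}
    (hku : Monomial fun j => word hrn k (u j)) (hkv : Monomial fun j => word hrn k (v j))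
    {γ : Fin r → FreeAct G r} (hγ : Monomial γ)
    (hu : ∀ j, word hrn i (u j) = endOf γ (word hrn k (u j)))
    (hv : ∀ j, word hrn i (v j) = endOf γ (word hrn k (v j))) :
    (genAt hr hrn i u)⁻¹ * genAt hr hrn i v = (genAt hr hrn k u)⁻¹ * genAt hr hrn k v := by
  obtain ⟨δ, hδ, -⟩ := hγ.exists_inverse
  have hidx : ∀ y : FreeAct G r, (endOf γ y).idx = (γ y.idx).idx := fun y => by
    rw [EndF.apply_eq, endOf_x]; rfl
  have hiu : Monomial fun j => word hrn i (u j) := fun a b hab => by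
    simp only [hu, hidx] at hab
    exact hku (hγ hab)
  have hiv : Monomial fun j => word hrn i (v j) := fun a b hab => by
    simp only [hv, hidx] at hab
    exact hkv (hγ hab)
  have mem : ∀ {i : KerIdx G n r} {u : ImIdx n r}, (Monomial fun j => word hrn i (u j)) →
      (i, u) ∈ GroupIdx G n r := fun h => h.mem_groupIdx hr
  have hsq : IsSingularSquare (idem ⟨(i, u), mem hiu⟩) (idem ⟨(i, v), mem hiv⟩)
      (idem ⟨(k, u), mem hku⟩) (idem ⟨(k, v), mem hkv⟩) := by
    refine isSingularSquare_of_ker (idem_mem _) (idem_mem _) (idem_mem _) (idem_mem _) ?_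
    intro y hy z hz hyz
    obtain ⟨a, ha⟩ := (mem_imSet_iff _ _).1 hy
    obtain ⟨b, hb⟩ := (mem_imSet_iff _ _).1 hz
    have h1 : rElt hrn i y = rElt hrn i z := by
      rw [← (rElt_spec hrn i).2] at hyz
      exact hyz
    rw [rElt_eq_iff] at h1
    have hya : word hrn i y.idx = endOf γ (word hrn k y.idx) := by rw [ha]; exact hu a
    have hzb : word hrn i z.idx = endOf γ (word hrn k z.idx) := by rw [hb]; exact hv b
    rw [hya, hzb, ← EndF.map_smul, ← EndF.map_smul] at h1
    have h2 := congrArg δ h1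
    rw [hδ, hδ, ← rElt_eq_iff] at h2
    rw [← (rElt_spec hrn k).2]
    exact h2
  rw [genAt_eq hr hrn (mem hiu), genAt_eq hr hrn (mem hiv), genAt_eq hr hrn (mem hku),
    genAt_eq hr hrn (mem hkv)]
  have := PresentedGroup.one_of_mem (rels := {w | Rels G hr hrn w})
    (Rels.square i k u v (mem hiu) (mem hiv) (mem hku) (mem hkv) hsq)
  rw [map_mul, map_inv, mul_inv_eq_one] at this
  simpa [gen, PresentedGroup.of] using this

theorem genAt_dist (hr : 1 ≤ r) (hrn : r ≤ n) (i : KerIdx G n r) :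
    genAt hr hrn i (dist hrn i) = 1 := by
  have hm : Monomial fun j => word hrn i (dist hrn i j) := by
    simp only [word_dist]; exact monomial_x
  rw [genAt_eq hr hrn (hm.mem_groupIdx hr)]
  exact PresentedGroup.one_of_mem (rels := {w | Rels G hr hrn w})
    (Rels.anchor i (hm.mem_groupIdx hr))

/-! ### Schreier words and entries equal to the identity -/

/-- The index `j` such that `u_{j-1} < t ≤ u_j`, and the last index if `t > u_r`. -/
def stepIdx (hr : 1 ≤ r) (u : ImIdx n r) (t : Fin n) : Fin r :=
  if h : (Finset.univ.filter fun j => t ≤ u j).Nonempty then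
    (Finset.univ.filter fun j => t ≤ u j).min' h
  else ⟨r - 1, Nat.sub_lt hr Nat.one_pos⟩

theorem stepElt_x (hr : 1 ≤ r) (u : ImIdx n r) (t : Fin n) :
    stepElt G hr u (x G t) = x G (u (stepIdx hr u t)) := by
  rw [stepElt, endOf_x, stepIdx]
  split_ifs <;> rfl

theorem lt_of_lt_stepIdx (hr : 1 ≤ r) (u : ImIdx n r) {t : Fin n} {j : Fin r}
    (h : j < stepIdx hr u t) : u j < t := by
  rw [stepIdx] at h
  split_ifs at h with hne
  · by_contra hlt
    exact absurd (Finset.min'_le _ j (by simpa using hlt)) (not_le.2 h)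
  · by_contra hlt
    exact hne ⟨j, by simpa using hlt⟩

theorem stepIdx_eq (hr : 1 ≤ r) (u : ImIdx n r) {t : Fin n} {j : Fin r} (h : t ≤ u j)
    (hlt : ∀ a < j, u a < t) : stepIdx hr u t = j := by
  have hne : (Finset.univ.filter fun j => t ≤ u j).Nonempty := ⟨j, by simpa using h⟩
  refine le_antisymm ?_ ?_
  · rw [stepIdx, dif_pos hne]
    exact Finset.min'_le _ _ (by simpa using h)
  · by_contra hlt'
    have h1 := hlt _ (not_le.1 hlt')
    rw [stepIdx, dif_pos hne] at h1
    have := Finset.min'_mem _ hne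
    rw [Finset.mem_filter] at this
    exact absurd this.2 (not_le.2 h1)

theorem exists_word_stepIdx (hr : 1 ≤ r) (hrn : r ≤ n) (u : ImIdx n r) :
    ∃ i : KerIdx G n r, word hrn i = fun t => x G (stepIdx hr u t) := by
  have hu : ∀ j, stepIdx hr u (u j) = j := fun j =>
    stepIdx_eq hr u le_rfl fun a ha => u.strictMono ha
  refine exists_word_eq hrn ⟨fun t j hj => ?_, fun j => ⟨u j, congrArg (x G) (hu j)⟩⟩
  rcases eq_or_lt_of_le hj with rfl | hlt
  · exact ⟨t, le_rfl, rfl⟩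
  · exact ⟨u j, (lt_of_lt_stepIdx hr u hlt).le, congrArg (x G) (hu j)⟩

theorem lower_apply (u : ImIdx n r) (h : (gaps u).Nonempty) (j : Fin r) :
    lower u h j = Function.update u ((gaps u).max' h)
      ⟨(u ((gaps u).max' h) : ℕ) - 1, lt_of_le_of_lt (Nat.sub_le _ _) (u ((gaps u).max' h)).2⟩ j :=
  rfl

/-- Lowering one entry of `u`, but not below its predecessor, does not affect the step indices. -/
theorem stepIdx_update (hr : 1 ≤ r) {u v : ImIdx n r} {j : Fin r} (hj : v j ≤ u j)
    (hne : ∀ a, a ≠ j → v a = u a) (a : Fin r) : stepIdx hr u (v a) = a := by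
  refine stepIdx_eq hr u ?_ fun b hb => ?_
  · by_cases ha : a = j
    · rw [ha]; exact hj
    · rw [hne a ha]
  · by_cases hb' : b = j
    · rw [hne a (fun h => absurd hb (by rw [h, hb']; exact lt_irrefl _))]
      exact u.strictMono hb
    · rw [← hne b hb']
      exact v.strictMono hb

/-- The word of `𝐫_i` is chosen to have the kernel of `α_u`. Hence `ε_{iu} = α_u`, and the recursion
defining `𝐡_u` is an instance of (R1). -/
theorem genAt_lower (hr : 1 ≤ r) {hrn : r ≤ n} {u : ImIdx n r} (h : (gaps u).Nonempty)
    {i : KerIdx G n r} (hi : word hrn i = fun t => x G (stepIdx hr u t)) :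
    genAt hr hrn i (lower u h) = genAt hr hrn i u := by
  have hu : ∀ j, stepIdx hr u (u j) = j := stepIdx_update (j := ⟨0, hr⟩) hr le_rfl fun _ _ => rfl
  have hlow : ∀ j, stepIdx hr u (lower u h j) = j := by
    refine stepIdx_update (j := (gaps u).max' h) hr ?_ fun a ha => ?_
    · rw [lower_apply, Function.update_self]
      exact Nat.sub_le _ _
    · rw [lower_apply, Function.update_of_ne ha]
  have hmu : (i, u) ∈ GroupIdx G n r :=
    Monomial.mem_groupIdx (hrn := hrn) hr (by simp only [hi, hu]; exact monomial_x)
  have hml : (i, lower u h) ∈ GroupIdx G n r :=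
    Monomial.mem_groupIdx (hrn := hrn) hr (by simp only [hi, hlow]; exact monomial_x)
  have hα : stepElt G hr u ∈ HClass i u := by
    constructor
    · rw [← (rElt_spec hrn i).2]
      ext y z
      change stepElt G hr u y = stepElt G hr u z ↔ rElt hrn i y = rElt hrn i z
      rw [rElt_eq_iff, hi, EndF.apply_eq, (stepElt G hr u).apply_eq z, stepElt_x, stepElt_x,
        FreeAct.ext_iff, FreeAct.ext_iff]
      simp only [smul_idx, smul_coeff, x, u.injective.eq_iff]
    · ext y
      rw [mem_imSet_iff]
      constructor
      · rintro ⟨z, rfl⟩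
        rw [EndF.apply_eq, stepElt_x]
        exact ⟨_, rfl⟩
      · rintro ⟨j, hj⟩
        refine ⟨y, ?_⟩
        rw [EndF.apply_eq, stepElt_x, hj, hu, ← hj, smul_x]
  have hid : idem ⟨(i, u), hmu⟩ = ⟨stepElt G hr u, stepElt_idempotent G hr u⟩ :=
    Subtype.ext (idempotent_unique (idem_mem _) hα (idem _).2 (stepElt_idempotent G hr u))
  have hw : schreierWord G hr (lower u h) * FreeMonoid.of (idem ⟨(i, u), hmu⟩) =
      schreierWord G hr u := by
    rw [hid]
    conv_rhs => rw [schreierWord, dif_pos h]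
  rw [genAt_eq hr hrn hml, genAt_eq hr hrn hmu]
  have := PresentedGroup.one_of_mem (rels := {w | Rels G hr hrn w})
    (Rels.schreier i (lower u h) u hml hmu hw)
  rw [map_mul, map_inv, mul_inv_eq_one] at this
  exact this

theorem le_of_not_nonempty_gaps {u : ImIdx n r} (h : ¬(gaps u).Nonempty) (j : Fin r) :
    (u j : ℕ) ≤ j := by
  obtain ⟨j, hj⟩ := j
  have hg : ∀ i, i ∉ gaps u := fun i hi => h ⟨i, hi⟩
  simp only [gaps, Finset.mem_filter, Finset.mem_univ, true_and, not_lt] at hg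
  induction j with
  | zero => simpa using hg ⟨0, hj⟩
  | succ j ih =>
    have h1 := hg ⟨j + 1, hj⟩
    rw [if_neg (Nat.succ_ne_zero j)] at h1
    have h2 := ih (by omega)
    exact h1.trans (Nat.succ_le_succ h2)

theorem le_orderEmb (u : ImIdx n r) (j : Fin r) : (j : ℕ) ≤ u j := by
  obtain ⟨j, hj⟩ := j
  induction j with
  | zero => exact Nat.zero_le _
  | succ j ih =>
    have h1 : u ⟨j, by omega⟩ < u ⟨j + 1, hj⟩ := u.strictMono (Nat.lt_succ_self j)
    exact Nat.succ_le_of_lt (lt_of_le_of_lt (ih (by omega)) h1)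

/-- Lowering the first entry in which `u` exceeds `v ≤ u` to the entry of `v`. -/
theorem exists_lower_toward {m : ℕ} {u v : Fin m ↪o Fin n} (hle : ∀ j, v j ≤ u j) (hne : u ≠ v) :
    ∃ (j : Fin m) (u' : Fin m ↪o Fin n), v j < u j ∧ (∀ a < j, u a = v a) ∧ u' j = v j ∧
      (∀ a, a ≠ j → u' a = u a) ∧ ∑ a, (u' a : ℕ) < ∑ a, (u a : ℕ) := by
  have hex : ∃ j, v j < u j := by
    by_contra hall
    push Not at hall
    exact hne (RelEmbedding.ext fun j => le_antisymm (hall j) (hle j))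
  have hne' : (Finset.univ.filter fun j => v j < u j).Nonempty := by
    obtain ⟨j, hj⟩ := hex
    exact ⟨j, by simpa using hj⟩
  obtain ⟨j, hj⟩ : ∃ j, j = (Finset.univ.filter fun j => v j < u j).min' hne' := ⟨_, rfl⟩
  have hjlt : v j < u j := by
    have := Finset.min'_mem _ hne'
    rw [← hj, Finset.mem_filter] at this
    exact this.2
  have hbelow : ∀ a < j, u a = v a := by
    intro a ha
    refine le_antisymm (not_lt.1 fun hlt => ?_) (hle a)
    have := Finset.min'_le (Finset.univ.filter fun j => v j < u j) a (by simpa using hlt)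
    rw [← hj] at this
    exact absurd ha (not_lt.2 this)
  -- As `j` is the first entry where the two differ, the new entry still exceeds all earlier ones.
  have hmono : StrictMono (Function.update u j (v j)) := by
    intro a b hab
    by_cases hb : b = j
    · subst hb
      rw [Function.update_self, Function.update_of_ne hab.ne, hbelow a hab]
      exact v.strictMono hab
    · rw [Function.update_of_ne hb]
      by_cases ha : a = j
      · subst ha
        rw [Function.update_self]
        exact hjlt.trans (u.strictMono hab)
      · rw [Function.update_of_ne ha]
        exact u.strictMono hab
  have hself : OrderEmbedding.ofStrictMono _ hmono j = v j := Function.update_self ..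
  have hother : ∀ a, a ≠ j → OrderEmbedding.ofStrictMono _ hmono a = u a :=
    fun a ha => Function.update_of_ne ha ..
  refine ⟨j, _, hjlt, hbelow, hself, hother, ?_⟩
  refine Finset.sum_lt_sum (fun a _ => ?_) ⟨j, Finset.mem_univ j, ?_⟩
  · by_cases ha : a = j
    · rw [ha, hself]; exact hle j
    · rw [hother a ha]
  · rw [hself]; exact hjlt

theorem genAt_square_same (hr : 1 ≤ r) {hrn : r ≤ n} {i k : KerIdx G n r} {u v : ImIdx n r}
    (hku : Monomial fun j => word hrn k (u j)) (hkv : Monomial fun j => word hrn k (v j))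
    (hu : ∀ j, word hrn i (u j) = word hrn k (u j))
    (hv : ∀ j, word hrn i (v j) = word hrn k (v j)) :
    (genAt hr hrn i u)⁻¹ * genAt hr hrn i v = (genAt hr hrn k u)⁻¹ * genAt hr hrn k v := by
  have hid : ∀ y : FreeAct G r, endOf (fun j => x G j) y = y := fun y => smul_x y
  exact genAt_square hr hku hkv monomial_x (fun j => by rw [hid, hu]) fun j => by rw [hid, hv]

/-- A generator `f_{i,u}` for which `𝐩_{ui}` is the identity is trivial. -/
theorem genAt_eq_one (hr : 1 ≤ r) {hrn : r ≤ n} {i : KerIdx G n r} {u : ImIdx n r}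
    (h : ∀ j, word hrn i (u j) = x G j) : genAt hr hrn i u = 1 := by
  obtain ⟨N, hN⟩ : ∃ N, N = ∑ j, (u j : ℕ) := ⟨_, rfl⟩
  induction N using Nat.strong_induction_on generalizing i u with
  | _ N ih =>
    subst hN
    have hle : ∀ j, dist hrn i j ≤ u j := by
      intro j
      have := dist_le hrn i (u j)
      rwa [h] at this
    by_cases hd : u = dist hrn i
    · rw [hd]; exact genAt_dist hr hrn i
    obtain ⟨j, v, hj, -, hvj, hvne, hsum⟩ := exists_lower_toward hle hd
    have hiv : ∀ a, word hrn i (v a) = x G a := by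
      intro a
      by_cases ha : a = j
      · rw [ha, hvj, word_dist]
      · rw [hvne a ha, h]
    -- Without gaps `u` is the least tuple and could not exceed the district at `j`.
    have hg : (gaps u).Nonempty := by
      by_contra hg
      have h1 := le_of_not_nonempty_gaps hg j
      have h2 := le_orderEmb (dist hrn i) j
      have h3 : (dist hrn i j : ℕ) < u j := hj
      omega
    -- The step word of `u` carries the identity at `u`, at `v` and at `lower u`. In the square on
    -- `i, k` and `u, v`, induction settles the two generators at `v`. The generator `f_{k,u}` is
    -- moved by (R1) to `lower u`, where induction applies again.
    obtain ⟨k, hk⟩ := exists_word_stepIdx (G := G) hr hrn u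
    have hku : ∀ a, word hrn k (u a) = x G a := fun a => by
      rw [hk]
      exact congrArg (x G) (stepIdx_update (j := j) hr le_rfl (fun _ _ => rfl) a)
    have hkv : ∀ a, word hrn k (v a) = x G a := fun a => by
      rw [hk]
      exact congrArg (x G) (stepIdx_update (j := j) hr (hvj.le.trans hj.le) hvne a)
    have hkl : ∀ a, word hrn k (lower u hg a) = x G a := fun a => by
      rw [hk]
      refine congrArg (x G) (stepIdx_update (j := (gaps u).max' hg) hr ?_ (fun b hb => ?_) a)
      · rw [lower_apply, Function.update_self]
        exact Nat.sub_le _ _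
      · rw [lower_apply, Function.update_of_ne hb]
    have hsq := genAt_square_same hr (hrn := hrn) (i := i) (k := k) (u := u) (v := v)
      (by simp only [hku]; exact monomial_x) (by simp only [hkv]; exact monomial_x)
      (fun a => by rw [h, hku]) fun a => by rw [hiv, hkv]
    rw [ih _ hsum hiv rfl, ih _ hsum hkv rfl, mul_left_inj, inv_inj, ← genAt_lower hr hg hk,
      ih _ (lower_sum_lt u hg) hkl rfl] at hsq
    exact hsq

end squares

/-! ### Rules for generators, and consistency of simple forms -/

section simple
variable {G : Type*} [Group G] {n r : ℕ}

/-- If `𝐫_i` and `𝐫_k` agree at the positions `u` and both carry the identity at the positions `v`,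
then `f_{i,u} = f_{k,u}`. -/
theorem genAt_congr_ker (hr : 1 ≤ r) {hrn : r ≤ n} {i k : KerIdx G n r} {u v : ImIdx n r}
    (hm : Monomial fun j => word hrn k (u j)) (hu : ∀ j, word hrn i (u j) = word hrn k (u j))
    (hi : ∀ j, word hrn i (v j) = x G j) (hk : ∀ j, word hrn k (v j) = x G j) :
    genAt hr hrn i u = genAt hr hrn k u := by
  have h := genAt_square_same hr (hrn := hrn) hm (v := v) (by simp only [hk]; exact monomial_x)
    hu fun j => by rw [hi, hk]
  rwa [genAt_eq_one hr hi, genAt_eq_one hr hk, mul_one, mul_one, inv_inj] at h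

/-- If `γ = 𝐩_{vi}`, and `𝐫_i` agrees at the positions `u` and `v` with `𝐫_k` followed by `γ`, then
`f_{i,u} = f_{i,v} f_{k,u}`. -/
theorem genAt_factor (hr : 1 ≤ r) {hrn : r ≤ n} {i k : KerIdx G n r} {u v : ImIdx n r}
    {γ : Fin r → FreeAct G r} (hγ : Monomial γ) (hm : Monomial fun j => word hrn k (u j))
    (hu : ∀ j, word hrn i (u j) = endOf γ (word hrn k (u j)))
    (hi : ∀ j, word hrn i (v j) = γ j) (hk : ∀ j, word hrn k (v j) = x G j) :
    genAt hr hrn i u = genAt hr hrn i v * genAt hr hrn k u := by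
  have h := genAt_square hr (hrn := hrn) hm (v := v) (by simp only [hk]; exact monomial_x) hγ
    hu fun j => by rw [hi, hk, endOf_x]
  rw [genAt_eq_one hr hk, mul_one, inv_mul_eq_iff_eq_mul] at h
  rw [h, inv_mul_cancel_right]

/-- Undoing the common subword by its inverse `δ` gives a kernel `k` with the identity at both `u`
and `v`. In the factorization through `k` the second factor is then trivial. As `v ≤ u`, the
positions `v` can serve as the early occurrences required for `k` to exist. -/
theorem genAt_congr_im (hr : 1 ≤ r) {hrn : r ≤ n} {i : KerIdx G n r} {u v : ImIdx n r}
    (hm : Monomial fun j => word hrn i (u j)) (huv : ∀ j, word hrn i (v j) = word hrn i (u j))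
    (hle : ∀ j, v j ≤ u j) : genAt hr hrn i u = genAt hr hrn i v := by
  obtain ⟨δ, hδ, hδ'⟩ := hm.exists_inverse
  have hδx : ∀ j, δ (word hrn i (u j)) = x G j := fun j => by
    rw [← hδ (x G j), endOf_x]
  obtain ⟨k, hk⟩ := exists_word_eqOn hr hrn (Set.range u ∪ Set.range v)
    (fun t => δ (word hrn i t)) v (fun j => Or.inr ⟨j, rfl⟩) (fun j => by rw [huv, hδx]) (by
      rintro t (⟨j, rfl⟩ | ⟨j, rfl⟩)
      · rw [hδx]; exact hle j
      · rw [huv, hδx]; exact le_rfl)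
  have hku : ∀ j, word hrn k (u j) = x G j := fun j => by rw [hk _ (Or.inl ⟨j, rfl⟩), hδx]
  have hkv : ∀ j, word hrn k (v j) = x G j := fun j => by
    rw [hk _ (Or.inr ⟨j, rfl⟩), huv, hδx]
  rw [genAt_factor hr (v := v) hm (by simp only [hku]; exact monomial_x)
    (fun j => by rw [hku, endOf_x]) huv hkv, genAt_eq_one hr hku, mul_one]

/-- The word `x_1 ⋯ x_r` with the letter `a x_k` inserted at position `s`. -/
def insWord (s : Fin (r + 1)) (k : Fin r) (a : G) : Fin (r + 1) → FreeAct G r :=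
  s.insertNth (α := fun _ => FreeAct G r) (a • x G k) fun j => x G j

theorem insWord_self (s : Fin (r + 1)) (k : Fin r) (a : G) : insWord s k a s = a • x G k :=
  Fin.insertNth_apply_same ..

theorem insWord_succAbove (s : Fin (r + 1)) (k : Fin r) (a : G) (j : Fin r) :
    insWord s k a (s.succAbove j) = x G j :=
  Fin.insertNth_apply_succAbove ..

/-- The word obtained from `insWord s k a` by deleting the letter `x_k`. -/
def simpleWord (s : Fin (r + 1)) (k : Fin r) (a : G) (j : Fin r) : FreeAct G r :=
  insWord s k a (k.castSucc.succAbove j)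

theorem insWord_castSucc {s : Fin (r + 1)} {j : Fin r} (k : Fin r) (a : G)
    (h : j.castSucc < s) : insWord s k a j.castSucc = x G j := by
  rw [← Fin.succAbove_of_castSucc_lt s j h, insWord_succAbove]

theorem insWord_succ {s : Fin (r + 1)} {j : Fin r} (k : Fin r) (a : G)
    (h : s ≤ j.castSucc) : insWord s k a j.succ = x G j := by
  rw [← Fin.succAbove_of_le_castSucc s j h, insWord_succAbove]

theorem monomial_simpleWord {s : Fin (r + 1)} {k : Fin r} (hks : k.castSucc < s) (a : G) :
    Monomial (simpleWord s k a) := by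
  have key : ∀ b c : Fin (r + 1), b ≠ k.castSucc → c ≠ k.castSucc →
      (insWord s k a b).idx = (insWord s k a c).idx → b = c := by
    have aux : ∀ j : Fin r, s.succAbove j ≠ k.castSucc → j ≠ k := by
      rintro j hj rfl
      exact hj (Fin.succAbove_of_castSucc_lt s j hks)
    intro b c hb hc h
    rcases Fin.eq_self_or_eq_succAbove s b with rfl | ⟨b, rfl⟩
    · rcases Fin.eq_self_or_eq_succAbove b c with rfl | ⟨c, rfl⟩
      · rfl
      · rw [insWord_self, insWord_succAbove] at h
        exact absurd h.symm (aux c hc)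
    · rcases Fin.eq_self_or_eq_succAbove s c with rfl | ⟨c, rfl⟩
      · rw [insWord_self, insWord_succAbove] at h
        exact absurd h (aux b hb)
      · rw [insWord_succAbove, insWord_succAbove] at h
        exact congrArg _ h
  intro b c h
  exact Fin.succAbove_right_injective
    (key _ _ (Fin.succAbove_ne _ _) (Fin.succAbove_ne _ _) h)

theorem simpleForm_simpleWord (hr : 1 ≤ r) (hrn : r ≤ n) {s : Fin (r + 1)} {k : Fin r}
    (hks : k.castSucc < s) (a : G) :
    SimpleForm hr hrn (twoRow hr fun j => incl hrn (simpleWord s k a j)) := by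
  have hks' : (k : ℕ) < s := hks
  -- Deleting `x_k` moves the letters between it and the inserted one a place to the left, so that
  -- `a x_k` lands in place `s - 1 = k + m`, counted from `0`.
  refine ⟨k, s - k - 1, by omega, a, congrArg (twoRow hr) (funext fun j => ?_)⟩
  rw [simpleWord]
  split_ifs with h1 h2
  · have hj : k.castSucc.succAbove j = (⟨j + 1, by omega⟩ : Fin r).castSucc := by
      rw [Fin.succAbove_of_le_castSucc _ _ (Fin.le_def.2 h1.1)]
      rfl
    have hlt : (⟨j + 1, by omega⟩ : Fin r).castSucc < s :=
      Fin.lt_def.2 (show (j : ℕ) + 1 < s by omega)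
    rw [hj, insWord_castSucc k a hlt]
    rfl
  · have hj : k.castSucc.succAbove j = s := by
      rw [Fin.succAbove_of_le_castSucc _ _ (Fin.le_def.2 (show (k : ℕ) ≤ j by omega))]
      exact Fin.ext (show (j : ℕ) + 1 = s by omega)
    rw [hj, insWord_self]
    rfl
  · by_cases hjk : (j : ℕ) < k
    · rw [Fin.succAbove_of_castSucc_lt _ _ (show j.castSucc < k.castSucc from hjk),
        insWord_castSucc k a (show j.castSucc < s from hjk.trans hks')]
      rfl
    · rw [Fin.succAbove_of_le_castSucc _ _ (show k.castSucc ≤ j.castSucc from not_lt.1 hjk),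
        insWord_succ k a (show s ≤ j.castSucc from Fin.le_def.2 (show (s : ℕ) ≤ j by omega))]
      rfl

/-- The positions `S` with the `k`-th one left out. -/
def deletePos (S : Fin (r + 1) ↪o Fin n) (k : Fin (r + 1)) : ImIdx n r :=
  (Fin.succAboveOrderEmb k).trans S

/-- The inserted `a x_k` comes after `x_k`, so the other positions carry the first occurrences of
all letters. This is the order condition of `exists_word_eqOn`. -/
theorem succAbove_insWord_idx_le {s : Fin (r + 1)} {k : Fin r} (hks : k.castSucc < s) (a : G)
    (b : Fin (r + 1)) : s.succAbove (insWord s k a b).idx ≤ b := by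
  rcases Fin.eq_self_or_eq_succAbove s b with rfl | ⟨b, rfl⟩
  · rw [insWord_self]
    change b.succAbove k ≤ b
    rw [Fin.succAbove_of_castSucc_lt _ _ hks]
    exact hks.le
  · rw [insWord_succAbove]
    exact le_rfl

open Classical in
/-- All generators `f_{i,u}` which arise by deleting `x_k` from an occurrence of `insWord s k a` in
the word of `𝐫_i` coincide. -/
theorem genAt_simpleWord_congr (hr : 1 ≤ r) {hrn : r ≤ n} {s : Fin (r + 1)} {k : Fin r}
    (hks : k.castSucc < s) (a : G) {i i' : KerIdx G n r} {S T : Fin (r + 1) ↪o Fin n}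
    (hS : ∀ b, word hrn i (S b) = insWord s k a b) (hT : ∀ b, word hrn i' (T b) = insWord s k a b) :
    genAt hr hrn i (deletePos S k.castSucc) = genAt hr hrn i' (deletePos T k.castSucc) := by
  have hn : r + 1 ≤ n := by
    simpa using Fintype.card_le_of_injective S S.injective
  have hmono := monomial_simpleWord hks a
  have base : ∀ {i i' : KerIdx G n r} {S : Fin (r + 1) ↪o Fin n},
      (∀ b, word hrn i (S b) = insWord s k a b) → (∀ b, word hrn i' (S b) = insWord s k a b) →
      genAt hr hrn i (deletePos S k.castSucc) = genAt hr hrn i' (deletePos S k.castSucc) := by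
    intro i i' S hS hS'
    have hw : (fun j => word hrn i' (deletePos S k.castSucc j)) = simpleWord s k a :=
      funext fun j => hS' _
    -- Deleting the inserted letter leaves the identity in both words.
    refine genAt_congr_ker hr (v := deletePos S s) (by rw [hw]; exact hmono)
      (fun j => (hS _).trans (hS' _).symm) (fun j => ?_) fun j => ?_
    · exact (hS _).trans (insWord_succAbove ..)
    · exact (hS' _).trans (insWord_succAbove ..)
  -- every occurrence can be moved to the first `r + 1` positions
  let S₀ : Fin (r + 1) ↪o Fin n := Fin.castLEOrderEmb hn
  obtain ⟨i₀, hi₀⟩ : ∃ i₀ : KerIdx G n r, ∀ b, word hrn i₀ (S₀ b) = insWord s k a b := by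
    obtain ⟨i₀, h⟩ := exists_word_eqOn hr hrn (Set.range S₀)
      (fun t => if h : (t : ℕ) < r + 1 then insWord s k a ⟨t, h⟩ else x G (⟨0, hr⟩ : Fin r))
      (deletePos S₀ s) (fun j => ⟨_, rfl⟩)
      (fun j => (dif_pos (s.succAbove j).2).trans (insWord_succAbove s k a j)) (by
        rintro t ⟨b, rfl⟩
        rw [dif_pos (show ((S₀ b : Fin n) : ℕ) < r + 1 from b.2)]
        exact S₀.monotone (succAbove_insWord_idx_le hks a b))
    exact ⟨i₀, fun b => (h _ ⟨b, rfl⟩).trans (dif_pos b.2)⟩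
  have main : ∀ {i : KerIdx G n r} {S : Fin (r + 1) ↪o Fin n},
      (∀ b, word hrn i (S b) = insWord s k a b) →
      genAt hr hrn i (deletePos S k.castSucc) = genAt hr hrn i₀ (deletePos S₀ k.castSucc) := by
    intro i S hS
    obtain ⟨N, hN⟩ : ∃ N, N = ∑ b, (S b : ℕ) := ⟨_, rfl⟩
    induction N using Nat.strong_induction_on generalizing i S with
    | _ N ih =>
      subst hN
      by_cases hSS : S = S₀
      · subst hSS; exact base hS hi₀
      obtain ⟨c, S', hc, hbelow, hc', hne, hsum⟩ :=
        exists_lower_toward (u := S) (v := S₀) (fun b => le_orderEmb S b) hSS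
      have hle : ∀ b, S' b ≤ S b := fun b => by
        by_cases hb : b = c
        · rw [hb, hc']; exact hc.le
        · rw [hne b hb]
      -- The new position is unoccupied: entries before `c` agree with `S₀`, and those from `c` on
      -- exceed `S₀ c`.
      have hnot : ∀ b, S b ≠ S' c := by
        intro b hb
        rcases lt_or_ge b c with hbc | hbc
        · rw [hbelow b hbc, hc'] at hb
          exact hbc.ne (S₀.injective hb)
        · have := S.monotone hbc
          rw [hb, hc'] at this
          exact absurd hc (not_lt.2 this)
      -- The `c`-th letter is written at its old and at its new position, so that both `S` and `S'`
      -- carry the extended word.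
      let e : Fin n → FreeAct G r := fun t =>
        if h : ∃ b, S b = t then insWord s k a h.choose else insWord s k a c
      have heS : ∀ b, e (S b) = insWord s k a b := by
        intro b
        have h : ∃ b', S b' = S b := ⟨b, rfl⟩
        exact (dif_pos h).trans (congrArg _ (S.injective h.choose_spec))
      have heS' : ∀ b, e (S' b) = insWord s k a b := by
        intro b
        by_cases hb : b = c
        · subst hb
          exact dif_neg fun ⟨d, hd⟩ => hnot d hd
        · rw [hne b hb, heS]
      obtain ⟨m, hm⟩ := exists_word_eqOn hr hrn (Set.range S ∪ Set.range S') e (deletePos S' s)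
        (fun j => Or.inr ⟨_, rfl⟩)
        (fun j => (heS' (s.succAbove j)).trans (insWord_succAbove s k a j)) (by
          rintro t (⟨b, rfl⟩ | ⟨b, rfl⟩)
          · rw [heS]
            exact (S'.monotone (succAbove_insWord_idx_le hks a b)).trans (hle b)
          · rw [heS']
            exact S'.monotone (succAbove_insWord_idx_le hks a b))
      have hmS : ∀ b, word hrn m (S b) = insWord s k a b := fun b => by
        rw [hm _ (Or.inl ⟨b, rfl⟩), heS]
      have hmS' : ∀ b, word hrn m (S' b) = insWord s k a b := fun b => by
        rw [hm _ (Or.inr ⟨b, rfl⟩), heS']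
      have hw : (fun j => word hrn m (deletePos S k.castSucc j)) = simpleWord s k a :=
        funext fun j => hmS _
      -- First the kernel changes from `i` to `m` with `S` fixed, then the positions move from `S`
      -- to `S'` within `m`.
      rw [base hS hmS, genAt_congr_im hr (v := deletePos S' k.castSucc) (by rw [hw]; exact hmono)
        (fun j => (hmS' _).trans (hmS _).symm) (fun j => hle _)]
      exact ih _ hsum hmS' rfl
  rw [main hS, main hT]

end simple

/-! ### Splitting off a simple factor -/

section factorization
variable {G : Type*} [Group G] {n r : ℕ}

/-- The letters beyond `s` are already used at their own positions. -/
theorem Monomial.idx_le_of_fixes_gt {w : Fin r → FreeAct G r} (hw : Monomial w) {s : Fin r}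
    (htail : ∀ j, s < j → w j = x G j) : (w s).idx ≤ s := by
  by_contra hlt
  rw [not_le] at hlt
  have h : s = (w s).idx := hw (show (w s).idx = (w (w s).idx).idx by rw [htail _ hlt]; rfl)
  exact hlt.ne h

/-- If `w` is the word of `𝐩_{ui}`, fixing the letters beyond `s` but not the letter at `s`, then
deleting `x_k` from some occurrence of `insWord s.succ k a` in the word of `𝐫_i` yields the
first factor of a factorization of `f_{i,u}`. -/
theorem exists_factorization (hr : 1 ≤ r) {hrn : r ≤ n} {i : KerIdx G n r} {u : ImIdx n r}
    (hm : Monomial fun j => word hrn i (u j)) {s : Fin r}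
    (htail : ∀ j, s < j → word hrn i (u j) = x G j) (hs : word hrn i (u s) ≠ x G s)
    {δ : EndF G r}
    (hδ : ∀ y, δ (endOf (simpleWord s.succ (word hrn i (u s)).idx (word hrn i (u s)).coeff) y) = y)
    (hδ' : ∀ y, endOf (simpleWord s.succ (word hrn i (u s)).idx (word hrn i (u s)).coeff) (δ y) = y) :
    ∃ (S : Fin (r + 1) ↪o Fin n) (m : KerIdx G n r),
      (∀ b, word hrn i (S b) =
        insWord s.succ (word hrn i (u s)).idx (word hrn i (u s)).coeff b) ∧
      (∀ j, word hrn m (u j) = δ (word hrn i (u j))) ∧ (∀ j, s ≤ j → word hrn m (u j) = x G j) ∧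
      genAt hr hrn i u =
        genAt hr hrn i (deletePos S (word hrn i (u s)).idx.castSucc) * genAt hr hrn m u := by
  obtain ⟨k, hk⟩ : ∃ k, k = (word hrn i (u s)).idx := ⟨_, rfl⟩
  obtain ⟨a, ha⟩ : ∃ a, a = (word hrn i (u s)).coeff := ⟨_, rfl⟩
  have hus : word hrn i (u s) = a • x G k := by rw [ha, hk, smul_x]
  rw [← hk, ← ha] at hδ hδ' ⊢
  have hks : k ≤ s := hk ▸ hm.idx_le_of_fixes_gt htail
  have hks' : k.castSucc < s.succ := Fin.castSucc_lt_succ_iff.2 hks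
  have hsurj : Function.Surjective fun j => (word hrn i (u j)).idx :=
    Finite.injective_iff_surjective.1 hm
  -- The letter `x_s` occurs in the subword at some place `j ≤ s`. Its first occurrence in the whole
  -- word is thus at most `u_s`, and equality would force the letter at `u_s` to be `x_s`.
  have hμs : dist hrn i s < u s := by
    obtain ⟨j, hj⟩ := hsurj s
    have hj : (word hrn i (u j)).idx = s := hj
    have h1 := dist_le hrn i (u j)
    rw [hj] at h1
    rcases lt_trichotomy j s with hlt | rfl | hlt
    · exact lt_of_le_of_lt h1 (u.strictMono hlt)
    · refine lt_of_le_of_ne h1 fun h => hs ?_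
      rw [← h, word_dist]
    · rw [htail j hlt] at hj
      exact absurd hj hlt.ne'
  -- The first occurrences of the letters up to `x_s`, then `u_s, …, u_r` shifted by one place. The
  -- letter `a x_k` at `u_s` is the inserted one.
  let S' : Fin (r + 1) → Fin n := fun b => if h : (b : ℕ) ≤ s then dist hrn i ⟨b, by omega⟩
    else u ⟨b - 1, by omega⟩
  have hS'mono : StrictMono S' := by
    intro b c hbc
    have hbc' : (b : ℕ) < c := hbc
    simp only [S']
    split_ifs with hb hc hc
    · exact (dist hrn i).strictMono hbc
    · refine lt_of_le_of_lt ((dist hrn i).monotone (show _ ≤ s from hb)) (lt_of_lt_of_le hμs ?_)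
      exact u.monotone (Fin.le_def.2 (show (s : ℕ) ≤ c - 1 by omega))
    · omega
    · exact u.strictMono (Fin.lt_def.2 (show (b : ℕ) - 1 < c - 1 by omega))
  let S : Fin (r + 1) ↪o Fin n := OrderEmbedding.ofStrictMono S' hS'mono
  have hSlow : ∀ j : Fin r, j ≤ s → S j.castSucc = dist hrn i j := fun j hj =>
    dif_pos (show (j.castSucc : ℕ) ≤ s from hj)
  have hShigh : ∀ j : Fin r, s ≤ j → S j.succ = u j := fun j hj =>
    dif_neg (show ¬(j.succ : ℕ) ≤ s from by
      have : (s : ℕ) ≤ j := hj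
      rw [Fin.val_succ]; omega)
  have hS : ∀ b, word hrn i (S b) = insWord s.succ k a b := by
    intro b
    rcases Fin.eq_self_or_eq_succAbove s.succ b with rfl | ⟨j, rfl⟩
    · rw [hShigh s le_rfl, hus, insWord_self]
    · rw [insWord_succAbove]
      rcases le_or_gt j s with hj | hj
      · rw [Fin.succAbove_of_castSucc_lt _ _ (Fin.castSucc_lt_succ_iff.2 hj), hSlow j hj, word_dist]
      · rw [Fin.succAbove_of_le_castSucc _ _ (Fin.succ_le_castSucc_iff.2 hj), hShigh j hj.le,
          htail j hj]
  let v : ImIdx n r := deletePos S k.castSucc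
  have hv : ∀ j, word hrn i (v j) = simpleWord s.succ k a j := fun j => hS _
  have hvu : ∀ j, s ≤ j → v j = u j := by
    intro j hj
    have : k.castSucc.succAbove j = j.succ :=
      Fin.succAbove_of_le_castSucc _ _ (Fin.castSucc_le_castSucc_iff.2 (hks.trans hj))
    change S (k.castSucc.succAbove j) = u j
    rw [this, hShigh j hj]
  have hδv : ∀ j, δ (word hrn i (v j)) = x G j := fun j => by
    rw [hv, ← hδ (x G j), endOf_x]
  -- The kernel `m` is obtained from `i` by undoing the simple word. It carries the identity at `v`,
  -- and for places `j ≥ s` the positions `u_j` and `v_j` coincide.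
  obtain ⟨m, hmw⟩ := exists_word_eqOn hr hrn (Set.range u ∪ Set.range v)
    (fun t => δ (word hrn i t)) v (fun j => Or.inr ⟨j, rfl⟩) hδv (by
      rintro t (⟨j, rfl⟩ | ⟨j, rfl⟩)
      · rcases le_or_gt s j with hj | hj
        · rw [← hvu j hj, hδv]; exact le_rfl
        -- For `j < s` the letter `x_l` at `u_j` has `l ≤ s`, and `l ≠ k` since `x_k` is taken at
        -- `u_s`. So the first occurrence of `x_l` survives in `v` and is at most `u_j`.
        obtain ⟨l, hl⟩ : ∃ l, l = (word hrn i (u j)).idx := ⟨_, rfl⟩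
        have hlk : l ≠ k := by
          intro h
          exact hj.ne (hm (show (word hrn i (u j)).idx = (word hrn i (u s)).idx by
            rw [← hl, h, hk]))
        have hls : l ≤ s := by
          by_contra hlt
          rw [not_le] at hlt
          have h1 : j = l := hm (show (word hrn i (u j)).idx = (word hrn i (u l)).idx by
            rw [htail l hlt, ← hl]; rfl)
          exact absurd (hj.trans hlt) (by rw [h1]; exact lt_irrefl _)
        obtain ⟨l', hl'⟩ := Fin.exists_succAbove_eq (fun h => hlk (Fin.castSucc_injective r h) :
          l.castSucc ≠ k.castSucc)
        have hvl : v l' = dist hrn i l := by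
          change S (k.castSucc.succAbove l') = _
          rw [hl', hSlow l hls]
        have hδl : δ (x G l) = x G l' := by
          rw [← hδv l', hvl, word_dist]
        have hidx : (δ (word hrn i (u j))).idx = l' := by
          rw [idx_apply, ← hl, hδl]; rfl
        rw [hidx, hvl, hl]
        exact dist_le hrn i (u j)
      · rw [hδv]; exact le_rfl)
  have hmu : ∀ j, word hrn m (u j) = δ (word hrn i (u j)) := fun j => hmw _ (Or.inl ⟨j, rfl⟩)
  have hmv : ∀ j, word hrn m (v j) = x G j := fun j => by rw [hmw _ (Or.inr ⟨j, rfl⟩), hδv]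
  have hmm : Monomial fun j => word hrn m (u j) := by
    intro b c h
    refine hm ?_
    simp only [hmu] at h
    change (word hrn i (u b)).idx = (word hrn i (u c)).idx
    rw [← hδ' (word hrn i (u b)), ← hδ' (word hrn i (u c)), idx_apply, h, ← idx_apply]
  refine ⟨S, m, hS, hmu, fun j hj => by rw [← hvu j hj, hmv], ?_⟩
  exact genAt_factor hr (monomial_simpleWord hks' a) hmm (fun j => by rw [hmu, hδ']) hv hmv

/-- The pairs for which `𝐩_{ui}` is a nonzero entry of simple form. -/
def IsSimple (hr : 1 ≤ r) (hrn : r ≤ n) (κ : GroupIdx G n r) : Prop :=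
  ∃ β : EndF G n, sandwich hr hrn κ.1.2 κ.1.1 = β ∧ SimpleForm hr hrn β

theorem simpleWord_one {s k : Fin r} (hks : k = s) :
    simpleWord (G := G) s.succ k 1 = fun j => x G j := by
  subst hks
  funext j
  rw [simpleWord]
  rcases lt_or_ge j k with h | h
  · rw [Fin.succAbove_of_castSucc_lt _ _ (Fin.castSucc_lt_castSucc_iff.2 h),
      insWord_castSucc _ _ (Fin.castSucc_lt_succ_iff.2 h.le)]
  · rw [Fin.succAbove_of_le_castSucc _ _ (Fin.castSucc_le_castSucc_iff.2 h)]
    rcases eq_or_lt_of_le h with rfl | h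
    · rw [insWord_self, one_smul]
    · rw [insWord_succ _ _ (Fin.succ_le_castSucc_iff.2 h)]

/-- Every `f_{i,u}` is a product of generators of simple form, and is determined by the
word of `𝐩_{ui}`. -/
theorem genAt_simple_prod_and_congr (hr : 1 ≤ r) {hrn : r ≤ n} (s : ℕ) (hsr : s ≤ r)
    {i : KerIdx G n r} {u : ImIdx n r} (hm : Monomial fun j => word hrn i (u j))
    (htail : ∀ j : Fin r, s ≤ j → word hrn i (u j) = x G j) :
    (∃ l : List (GroupIdx G n r), l ≠ [] ∧ (∀ κ ∈ l, IsSimple hr hrn κ) ∧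
      genAt hr hrn i u = (l.map (gen hr hrn)).prod) ∧
    ∀ (i' : KerIdx G n r) (u' : ImIdx n r), (∀ j, word hrn i' (u' j) = word hrn i (u j)) →
      genAt hr hrn i u = genAt hr hrn i' u' := by
  induction s generalizing i u with
  | zero =>
    have hx : ∀ j, word hrn i (u j) = x G j := fun j => htail j (Nat.zero_le _)
    have hmem : (i, u) ∈ GroupIdx G n r := hm.mem_groupIdx hr
    refine ⟨⟨[⟨(i, u), hmem⟩], by simp, ?_, by simp [genAt_eq hr hrn hmem]⟩, fun i' u' h => ?_⟩
    · intro κ hκ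
      rw [List.mem_singleton] at hκ
      subst hκ
      refine ⟨_, sandwich_eq hr hrn hm, ?_⟩
      -- The identity has simple form, with `m = 0` and `a = 1`, so the product can be nonempty here
      -- too.
      have := simpleForm_simpleWord (G := G) hr hrn
        (Fin.castSucc_lt_succ_iff.2 (le_refl (⟨0, hr⟩ : Fin r))) 1
      rw [simpleWord_one rfl] at this
      simpa only [hx] using this
    · rw [genAt_eq_one hr hx, genAt_eq_one hr fun j => by rw [h, hx]]
  | succ s ih =>
    obtain ⟨s', hs'⟩ : ∃ s' : Fin r, (s' : ℕ) = s := ⟨⟨s, hsr⟩, rfl⟩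
    by_cases hfix : word hrn i (u s') = x G s'
    · refine ih (by omega) hm fun j hj => ?_
      rcases eq_or_lt_of_le hj with h | h
      · rw [show j = s' from Fin.ext (h.symm.trans hs'.symm), hfix]
      · exact htail j h
    have htail' : ∀ j, s' < j → word hrn i (u j) = x G j := fun j hj =>
      htail j (by rw [← hs']; exact hj)
    have hks := hm.idx_le_of_fixes_gt htail'
    have hks' : (word hrn i (u s')).idx.castSucc < s'.succ := Fin.castSucc_lt_succ_iff.2 hks
    have hγ := monomial_simpleWord hks' (word hrn i (u s')).coeff
    obtain ⟨δ, hδ, hδ'⟩ := hγ.exists_inverse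
    obtain ⟨S, m, hS, hmu, hmtail, hfac⟩ :=
      exists_factorization hr hm htail' hfix hδ hδ'
    have hδm : ∀ {m' : KerIdx G n r} {v : ImIdx n r},
        (∀ j, word hrn m' (v j) = δ (word hrn i (u j))) →
        Monomial fun j => word hrn m' (v j) := by
      intro m' v hmv b c h
      refine hm ?_
      simp only [hmv] at h
      change (word hrn i (u b)).idx = (word hrn i (u c)).idx
      rw [← hδ' (word hrn i (u b)), ← hδ' (word hrn i (u c)), idx_apply, h, ← idx_apply]
    obtain ⟨⟨l, hl, hsimple, hprod⟩, hcongr⟩ :=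
      ih (by omega) (hδm hmu) fun j hj => hmtail j (Fin.le_def.2 (hs'.le.trans hj))
    have hvw : (fun j => word hrn i (deletePos S (word hrn i (u s')).idx.castSucc j)) =
        simpleWord s'.succ (word hrn i (u s')).idx (word hrn i (u s')).coeff :=
      funext fun j => hS _
    have hvm : Monomial fun j =>
        word hrn i (deletePos S (word hrn i (u s')).idx.castSucc j) := by
      rw [hvw]; exact hγ
    have hmem := hvm.mem_groupIdx hr
    refine ⟨⟨⟨_, hmem⟩ :: l, by simp, ?_, ?_⟩, fun i' u' h => ?_⟩
    · intro κ hκ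
      rcases List.mem_cons.1 hκ with rfl | hκ
      · refine ⟨_, sandwich_eq hr hrn hvm, ?_⟩
        have := simpleForm_simpleWord hr hrn hks' (word hrn i (u s')).coeff
        rw [← hvw] at this
        exact this
      · exact hsimple κ hκ
    · rw [List.map_cons, List.prod_cons, ← hprod, hfac, genAt_eq hr hrn hmem]
    · have hw : (fun j => word hrn i' (u' j)) = fun j => word hrn i (u j) := funext h
      -- The simple factor depends only on the common subword, so the same `δ` serves for `i'` and
      -- `u'`. The first factors agree by `genAt_simpleWord_congr`, the remaining ones by induction.
      obtain ⟨S', m', hS', hmu', -, hfac'⟩ :=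
        exists_factorization hr (hrn := hrn) (i := i') (u := u') (s := s') (δ := δ)
          (by rw [hw]; exact hm) (fun j hj => by rw [h, htail' j hj]) (by rw [h]; exact hfix)
          (by rw [h]; exact hδ) (by rw [h]; exact hδ')
      rw [h] at hS' hfac'
      rw [hfac, hfac', genAt_simpleWord_congr hr hks' _ hS hS',
        hcongr m' u' fun j => by rw [hmu', hmu, h]]

end factorization

end FreeActIG

/-! ### Consistency and factorization of all entries -/

theorem proposition8p5 {G : Type*} [Group G] (n r : ℕ) (hr : 1 ≤ r) (hrn : r + 2 ≤ n) :
    have hle : r ≤ n := le_trans (Nat.le_add_right r 2) hrn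
    (∀ α : FreeActIG.EndF G n,
      (∃ (u : FreeActIG.ImIdx n r) (i : FreeActIG.KerIdx G n r),
        FreeActIG.sandwich hr hle u i = α) →
      FreeActIG.Consistent hr hle α) ∧
    (∀ (α : FreeActIG.EndF G n) (u : FreeActIG.ImIdx n r) (j : FreeActIG.KerIdx G n r)
      (h : FreeActIG.sandwich hr hle u j = α),
      ∃ w : List (FreeActIG.GroupIdx G n r), w ≠ [] ∧
        (∀ κ ∈ w, ∃ β : FreeActIG.EndF G n,
          FreeActIG.sandwich hr hle κ.1.2 κ.1.1 = β ∧ FreeActIG.SimpleForm hr hle β) ∧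
        FreeActIG.gen hr hle ⟨(j, u), FreeActIG.mem_groupIdx h⟩ =
          (w.map (FreeActIG.gen hr hle)).prod) := by
  intro hle
  refine ⟨fun α _ i j u v hu hv => ?_, fun α u j h => ?_⟩
  · obtain ⟨hum, hua⟩ := FreeActIG.eq_of_sandwich_eq hr hle hu
    obtain ⟨-, hva⟩ := FreeActIG.eq_of_sandwich_eq hr hle hv
    -- For `s = r` no letter is required to be fixed.
    have := (FreeActIG.genAt_simple_prod_and_congr hr r le_rfl hum fun j hj =>
      absurd j.2 (not_lt.2 hj)).2 j v fun a =>
        FreeActIG.incl_injective hle ((hva a).symm.trans (hua a))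
    rwa [FreeActIG.genAt_eq hr hle (FreeActIG.mem_groupIdx hu),
      FreeActIG.genAt_eq hr hle (FreeActIG.mem_groupIdx hv)] at this
  · obtain ⟨hm, -⟩ := FreeActIG.eq_of_sandwich_eq hr hle h
    rw [← FreeActIG.genAt_eq hr hle (FreeActIG.mem_groupIdx h)]
    exact (FreeActIG.genAt_simple_prod_and_congr hr r le_rfl hm fun j hj =>
      absurd j.2 (not_lt.2 hj)).1
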